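/- **Setting.** Let $n\ge 1$ agents choose decisions in a convex closed set $\mathbb X\subseteq\mathbb R^p$ with $\|x\|\le R$ for all $x\in\mathbb X$. For every agent $i$ and time $t\in\mathbb N_+$ let $f_{i,t}:\mathbb X\to\mathbb R$ and $g_{i,t}:\mathbb X\to\mathbb R^{m_i}$ be convex (componentwise for $g_{i,t}$) with $|f_{i,t}(x)-f_{i,t}(y)|\le F_1$ and $\|g_{i,t}(x)\|\le F_1$ for all $x,y\in\mathbb X$, and let $\partial f_{i,t}(x)\in\mathbb R^p$, $\partial g_{i,t}(x)\in\mathbb R^{p\times m_i}$ be subgradients at $x\in\mathbb X$ (the columns of $\partial g_{i,t}(x)$ are subgradients of the components of $g_{i,t}$) with $\|\partial f_{i,t}(x)\|\le F_2$ and $\|\partial g_{i,t}(x)\|\le F_2$. Write $[\cdot]_+$ for the componentwise positive part, and let $\partial[g_{i,t}(x)]_+$ be a subgradient of $[g_{i,t}]_+$ at $x$ whose columns are the columns of $\partial g_{i,t}(x)$ multiplied by numbers in $[0,1]$ (the rule for the maximum of a convex function and $0$). Put $f_t=\frac1n\sum_{j=1}^n f_{j,t}$, $g_t=\mathrm{col}(g_{1,t},\dots,g_{n,t})$,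 and let $$\mathcal X_T=\{(y_1,\dots,y_T): y_t\in\mathbb X,\ g_t(y_t)\le 0\ \ \forall t\in[T]\}.$$ Assume that $\mathcal X_T$ contains a constant sequence. At time $t$ the agents communicate over a directed graph $([n],\mathcal E_t)$ with mixing matrix $W_t\in\mathbb R^{n\times n}$ such that $[W_t]_{ij}>0$ if $(j,i)\in\mathcal E_t$ or $i=j$, and $[W_t]_{ij}=0$ otherwise. For all $t\in\mathbb N_+$: all positive entries of $W_t$ are at least $w\in(0,1)$, $W_t$ is doubly stochastic, and the graph $([n],\bigcup_{l=0}^{B-1}\mathcal E_{t+l})$ is strongly connected, where $B\ge1$ is a fixed integer. **Algorithm.** Let $c>1$, $\kappa\in(0,1)$ and, for $t\in\mathbb N_+$, $$\tau_t=\frac1{c^t},\quad \Psi_t=\sum_{s=1}^t\tau_s,\quad \alpha_t=\sqrt{\Psi_t/t},\quad \beta_t=\frac1{t^{\kappa}},\quad \gamma_t=\frac1{t^{1-\kappa}}.$$ Start with any $x_{i,1}\in\mathbb X$, $\hat x_{i,1}=x_{i,1}$, $q_{i,1}=0\in\mathbb R^{m_i}$. For $t=1,\dots,T-1$ and every agent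 $i$ set $$z_{i,t+1}=\sum_{j=1}^n[W_t]_{ij}\hat x_{j,t},\qquad \omega_{i,t+1}=\partial f_{i,t}(x_{i,t})+\partial[g_{i,t}(x_{i,t})]_+\,q_{i,t},\qquad x_{i,t+1}=\mathcal P_{\mathbb X}(z_{i,t+1}-\alpha_{t+1}\omega_{i,t+1}),$$ $$q_{i,t+1}=\Big[(1-\beta_{t+1}\gamma_{t+1})q_{i,t}+\gamma_{t+1}\Big([g_{i,t}(x_{i,t})]_++\big(\partial[g_{i,t}(x_{i,t})]_+\big)^{T}(x_{i,t+1}-x_{i,t})\Big)\Big]_+,$$ where $\mathcal P_{\mathbb X}$ is the Euclidean projection onto $\mathbb X$; then set $\hat x_{i,t+1}=x_{i,t+1}$ if $\|x_{i,t+1}-\hat x_{i,t}\|\ge\tau_{t+1}$, and $\hat x_{i,t+1}=\hat x_{i,t}$ otherwise. **Claim.** For every $T\in\mathbb N_+$ and every comparator sequence $y_{[T]}=(y_1,\dots,y_T)\in\mathcal X_T$ with path-length $P_T=\sum_{t=1}^{T-1}\|y_{t+1}-y_t\|$, $$\text{Net-Reg}:=\frac1n\sum_{i=1}^n\sum_{t=1}^T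 f_t(x_{i,t})-\sum_{t=1}^T f_t(y_t)\ \le\ C\big(T^{\max\{\kappa,1/2\}}+T^{1/2}P_T\big),$$ $$\text{Net-CCV}:=\frac1n\sum_{i=1}^n\sum_{t=1}^T\big\|[g_t(x_{i,t})]_+\big\|\ \le\ C\,T^{\max\{1-\kappa/2,\,3/4\}},$$ where $C>0$ depends only on $n,m_1,\dots,m_n,F_1,F_2,R,w,B,\kappa,c$. -/

import Mathlib

open scoped BigOperators

noncomputable section

namespace EventTriggered

/-- `ℝ^d` with the Euclidean norm. -/
abbrev Vec (d : ℕ) : Type := EuclideanSpace ℝ (Fin d)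

/-- `[v]₊`, the projection of `v` onto the nonnegative orthant: the positive part of each
coordinate. -/
def nonnegPart {ι : Type} (v : EuclideanSpace ℝ ι) : EuclideanSpace ℝ ι :=
  WithLp.toLp 2 fun k => max (v k) 0

/-- `x` is the Euclidean projection of `u` onto `K`, i.e. the minimizer of `‖u - y‖²` over
`y ∈ K`. -/
def IsProjection {d : ℕ} (K : Set (Vec d)) (u x : Vec d) : Prop :=
  x ∈ K ∧ ∀ y ∈ K, ‖u - x‖ ^ 2 ≤ ‖u - y‖ ^ 2

/-- `v` is a subgradient at `x` of the real function `f` on `K`. -/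
def IsSubgradient {d : ℕ} (K : Set (Vec d)) (f : Vec d → ℝ) (x v : Vec d) : Prop :=
  ∀ y ∈ K, f x + inner ℝ v (y - x) ≤ f y

/-- The `d × k` matrix `G`, viewed as a linear map `ℝ^k → ℝ^d`, is a subgradient at `x` of the
vector-valued function `g` on `K`: its columns are subgradients of the components of `g`. -/
def IsSubgradientMatrix {d k : ℕ} (K : Set (Vec d)) (g : Vec d → Vec k) (x : Vec d)
    (G : Vec k →L[ℝ] Vec d) : Prop :=
  ∀ l : Fin k, IsSubgradient K (fun y => g y l) x (G (EuclideanSpace.single l 1))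

/-- The data of the problem for `n` agents with decisions in `ℝ^p` and `m i` constraints for
agent `i`. Iterations are numbered `1, 2, 3, …`; the values at time `0` are never used, and the
functions are only used on the decision set. -/
structure Problem (n p : ℕ) (m : Fin n → ℕ) where
  /-- the decision set -/
  X : Set (Vec p)
  /-- the local loss functions `f_{i,t}` -/
  f : Fin n → ℕ → Vec p → ℝ
  /-- the local constraint functions `g_{i,t}` -/
  g : (i : Fin n) → ℕ → Vec p → Vec (m i)
  /-- the subgradients `∂f_{i,t}(x)` -/
  subf : Fin n → ℕ → Vec p → Vec p
  /-- the subgradients `∂g_{i,t}(x)` -/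
  subg : (i : Fin n) → ℕ → Vec p → (Vec (m i) →L[ℝ] Vec p)
  /-- the subgradients `∂[g_{i,t}(x)]₊` -/
  subgPos : (i : Fin n) → ℕ → Vec p → (Vec (m i) →L[ℝ] Vec p)
  /-- the communication graphs; `(graph t).Adj j i` means that `i` can receive from `j` -/
  graph : ℕ → Digraph (Fin n)
  /-- the mixing matrices -/
  W : ℕ → Matrix (Fin n) (Fin n) ℝ

namespace Problem

variable {n p : ℕ} {m : Fin n → ℕ}

/-- The global loss function `f_t = (1/n) ∑_j f_{j,t}`. -/
def globalLoss (P : Problem n p m) (t : ℕ) (x : Vec p) : ℝ :=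
  (1 / (n : ℝ)) * ∑ j : Fin n, P.f j t x

/-- The global constraint function `g_t = col(g_{1,t}, …, g_{n,t})`. -/
def globalConstraint (P : Problem n p m) (t : ℕ) (x : Vec p) :
    EuclideanSpace ℝ ((i : Fin n) × Fin (m i)) :=
  WithLp.toLp 2 fun k => P.g k.1 t x k.2

/-- The feasible decision sequences `(y_1, …, y_T)` (the other values of `y` are irrelevant). -/
def feasibleSequences (P : Problem n p m) (T : ℕ) : Set (ℕ → Vec p) :=
  {y | ∀ t ∈ Finset.Icc 1 T, y t ∈ P.X ∧ ∀ k, P.globalConstraint t (y t) k ≤ 0}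

/-- The points whose constant sequence of length `T` is feasible. -/
def feasibleStatic (P : Problem n p m) (T : ℕ) : Set (Vec p) :=
  {x | x ∈ P.X ∧ ∀ t ∈ Finset.Icc 1 T, ∀ k, P.globalConstraint t x k ≤ 0}

/-- Assumptions on the decision set, the losses, the constraints and their subgradients. The norm
of `subg` is the operator norm, i.e. the spectral norm of the matrix. -/
structure RegularData (P : Problem n p m) (F₁ F₂ R : ℝ) : Prop where
  convex : Convex ℝ P.X
  closed : IsClosed P.X
  bounded : ∀ x ∈ P.X, ‖x‖ ≤ R
  f_convex : ∀ i t, 1 ≤ t → ConvexOn ℝ P.X (P.f i t)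
  g_convex : ∀ i t, 1 ≤ t → ∀ l : Fin (m i), ConvexOn ℝ P.X (fun x => P.g i t x l)
  f_bound : ∀ i t, 1 ≤ t → ∀ x ∈ P.X, ∀ y ∈ P.X, |P.f i t x - P.f i t y| ≤ F₁
  g_bound : ∀ i t, 1 ≤ t → ∀ x ∈ P.X, ‖P.g i t x‖ ≤ F₁
  subf_spec : ∀ i t, 1 ≤ t → ∀ x ∈ P.X, IsSubgradient P.X (P.f i t) x (P.subf i t x)
  subg_spec : ∀ i t, 1 ≤ t → ∀ x ∈ P.X, IsSubgradientMatrix P.X (P.g i t) x (P.subg i t x)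
  subf_bound : ∀ i t, 1 ≤ t → ∀ x ∈ P.X, ‖P.subf i t x‖ ≤ F₂
  subg_bound : ∀ i t, 1 ≤ t → ∀ x ∈ P.X, ‖P.subg i t x‖ ≤ F₂

/-- `subgPos` is a subgradient of `[g]₊`, of the form given by the calculus rule for the maximum of
a convex function and `0`: each column is `θ ∂g_l` for some `θ ∈ [0,1]`. (Where `g_l > 0` one can
take `θ = 1`, where `g_l < 0` one can take `θ = 0`, and where `g_l = 0` any `θ`.) -/
structure PosPartSubgradients (P : Problem n p m) : Prop where
  isSubgradient : ∀ i t, 1 ≤ t → ∀ x ∈ P.X,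
    IsSubgradientMatrix P.X (fun y => nonnegPart (P.g i t y)) x (P.subgPos i t x)
  chain_rule : ∀ i t, 1 ≤ t → ∀ x ∈ P.X, ∀ l : Fin (m i), ∃ θ ∈ Set.Icc (0 : ℝ) 1,
    P.subgPos i t x (EuclideanSpace.single l 1) = θ • P.subg i t x (EuclideanSpace.single l 1)

/-- Assumptions on the time-varying communication graph and its mixing matrices. -/
structure RegularNetwork (P : Problem n p m) (w : ℝ) (B : ℕ) : Prop where
  weight_pos : ∀ t, 1 ≤ t → ∀ i j, (P.graph t).Adj j i ∨ i = j → 0 < P.W t i j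
  weight_zero : ∀ t, 1 ≤ t → ∀ i j, ¬ ((P.graph t).Adj j i ∨ i = j) → P.W t i j = 0
  weight_lower : ∀ t, 1 ≤ t → ∀ i j, 0 < P.W t i j → w ≤ P.W t i j
  col_sum : ∀ t, 1 ≤ t → ∀ j, ∑ i, P.W t i j = 1
  row_sum : ∀ t, 1 ≤ t → ∀ i, ∑ j, P.W t i j = 1
  /-- the union of any `B` consecutive graphs is strongly connected -/
  jointly_connected : ∀ t, 1 ≤ t → ∀ i j : Fin n,
    Relation.ReflTransGen (fun a b => ∃ l < B, (P.graph (t + l)).Adj a b) i j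

end Problem

/-- The variables of the algorithm: decisions `x_{i,t}`, last broadcast decisions `xhat_{i,t}`,
consensus variables `z_{i,t}`, update directions `ω_{i,t}` and dual variables `q_{i,t}`. -/
structure Trajectory (n p : ℕ) (m : Fin n → ℕ) where
  x : Fin n → ℕ → Vec p
  xhat : Fin n → ℕ → Vec p
  z : Fin n → ℕ → Vec p
  ω : Fin n → ℕ → Vec p
  q : (i : Fin n) → ℕ → Vec (m i)

/-- `S` is generated, up to iteration `T`, by the distributed event-triggered online primal-dual
algorithm with step sizes `α`, `β`, regularization parameters `γ` and thresholds `τ`. -/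
structure IsGenerated {n p : ℕ} {m : Fin n → ℕ} (P : Problem n p m) (α β γ τ : ℕ → ℝ) (T : ℕ)
    (S : Trajectory n p m) : Prop where
  init_x : ∀ i, S.x i 1 ∈ P.X
  init_xhat : ∀ i, S.xhat i 1 = S.x i 1
  init_q : ∀ i, S.q i 1 = 0
  step_z : ∀ i t, 1 ≤ t → t < T → S.z i (t + 1) = ∑ j, P.W t i j • S.xhat j t
  step_ω : ∀ i t, 1 ≤ t → t < T →
    S.ω i (t + 1) = P.subf i t (S.x i t) + P.subgPos i t (S.x i t) (S.q i t)
  step_x : ∀ i t, 1 ≤ t → t < T →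
    IsProjection P.X (S.z i (t + 1) - α (t + 1) • S.ω i (t + 1)) (S.x i (t + 1))
  step_q : ∀ i t, 1 ≤ t → t < T →
    S.q i (t + 1) = nonnegPart ((1 - β (t + 1) * γ (t + 1)) • S.q i t +
      γ (t + 1) • (nonnegPart (P.g i t (S.x i t)) +
        ContinuousLinearMap.adjoint (P.subgPos i t (S.x i t)) (S.x i (t + 1) - S.x i t)))
  step_xhat : ∀ i t, 1 ≤ t → t < T →
    S.xhat i (t + 1) =
      if τ (t + 1) ≤ ‖S.x i (t + 1) - S.xhat i t‖ then S.x i (t + 1) else S.xhat i t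

/-- Network regret of the decisions `x_{i,t}` against the benchmark `(y_1, …, y_T)`. -/
def netReg {n p : ℕ} {m : Fin n → ℕ} (P : Problem n p m) (T : ℕ) (x : Fin n → ℕ → Vec p)
    (y : ℕ → Vec p) : ℝ :=
  (1 / (n : ℝ)) * ∑ i, ∑ t ∈ Finset.Icc 1 T, P.globalLoss t (x i t)
    - ∑ t ∈ Finset.Icc 1 T, P.globalLoss t (y t)

/-- Network cumulative constraint violation of the decisions `x_{i,t}`. -/
def netCCV {n p : ℕ} {m : Fin n → ℕ} (P : Problem n p m) (T : ℕ) (x : Fin n → ℕ → Vec p) : ℝ :=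
  (1 / (n : ℝ)) * ∑ i, ∑ t ∈ Finset.Icc 1 T, ‖nonnegPart (P.globalConstraint t (x i t))‖

/-- The path-length `P_T = ∑_{t=1}^{T-1} ‖y_{t+1} - y_t‖`. -/
def pathLength {p : ℕ} (T : ℕ) (y : ℕ → Vec p) : ℝ :=
  ∑ t ∈ Finset.Ico 1 T, ‖y (t + 1) - y t‖

/-- The thresholds `τ_t = 1 / c^t`. -/
def geomThreshold (c : ℝ) (t : ℕ) : ℝ := 1 / c ^ t

/-- The step sizes `α_t = √(Ψ_t / t)` with `Ψ_t = ∑_{s=1}^t τ_s`. -/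
def stepAlpha (τ : ℕ → ℝ) (t : ℕ) : ℝ := Real.sqrt ((∑ s ∈ Finset.Icc 1 t, τ s) / t)

/-- The step sizes `β_t = 1 / t^κ`. -/
def stepBeta (κ : ℝ) (t : ℕ) : ℝ := 1 / (t : ℝ) ^ κ

/-- The regularization parameters `γ_t = 1 / t^(1-κ)`. -/
def regGamma (κ : ℝ) (t : ℕ) : ℝ := 1 / (t : ℝ) ^ (1 - κ)

end EventTriggered

end

/-! The proof compares the agents with a feasible sequence through one primal-dual inequality, in
which the squared primal steps survive on the left and pay for the network errors.

For one agent and one round, the projection inequality, the subgradient inequalities and the dual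
update against a fixed multiplier with all coordinates equal to `r` give `primal_dual_step_le`. The
multiplier turns the dual gap into `r` times the constraint violation. Summed
(`IsGenerated.localRegret_add_le`), local regret plus `r` times local violation plus half the step
energy `Q` is at most of order `T^κ + r² T^(1-κ) + √T (1 + P_T)` plus `1 + r` times the total
movement. The dual terms telescope because `β_t γ_t = 1/t`; the primal ones because `α_t` decreases
and mixing by a doubly stochastic matrix does not increase the sum of squared distances.

Broadcasting and mixing form a perturbed averaging iteration. Joint connectivity makes products of
`n * B` mixing matrices entrywise at least `w^(n * B)`, hence contracting, so the summed
disagreement and movement are `O(1 + A)`, where `A` is the summed length of the primal steps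
(`exists_consensus_bound`). The triggering errors are summable and only enter the constant.

By AM-GM, `A ≤ Q / s + s * O(√T)` for every `s > 0`. With `r = 0` and `s` a large constant, `Q`
absorbs `A`, which gives the regret bound. For the violation a constant comparator is used: local
regret is at least `-O(T)`, so `Q = O(T)`; then `s = T^(1/4)` gives `A = O(T^(3/4))`, and `r =
T^(κ/2)` in the basic inequality, divided by `r`, gives `T^(1-κ/2) + T^(3/4)`. -/

namespace EventTriggered

/-! ### Perturbed averaging over a jointly connected network -/

section Consensus

variable {n : ℕ} {E : Type*} [NormedAddCommGroup E] [NormedSpace ℝ E]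

/-- The average of `n` vectors. -/
noncomputable def mean (v : Fin n → E) : E := (1 / (n : ℝ)) • ∑ j, v j

/-- The total distance of `n` vectors to their average. -/
noncomputable def deviation (v : Fin n → E) : ℝ := ∑ i, ‖v i - mean v‖

/-- The action of a matrix on `n`-tuples of vectors. -/
def mix (M : Matrix (Fin n) (Fin n) ℝ) (v : Fin n → E) (i : Fin n) : E := ∑ j, M i j • v j

lemma deviation_nonneg (v : Fin n → E) : 0 ≤ deviation v :=
  Finset.sum_nonneg fun _ _ => norm_nonneg _

lemma mean_add (u v : Fin n → E) : mean (u + v) = mean u + mean v := by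
  simp [mean, Finset.sum_add_distrib]

lemma deviation_add_le (u v : Fin n → E) : deviation (u + v) ≤ deviation u + deviation v := by
  unfold deviation
  rw [← Finset.sum_add_distrib]
  refine Finset.sum_le_sum fun i _ => ?_
  rw [mean_add, Pi.add_apply, add_sub_add_comm]
  exact norm_add_le _ _

lemma norm_mean_le (v : Fin n → E) : ‖mean v‖ ≤ (1 / (n : ℝ)) * ∑ i, ‖v i‖ := by
  unfold mean
  rw [norm_smul, Real.norm_of_nonneg (by positivity)]
  gcongr
  exact norm_sum_le _ _

lemma deviation_le (v : Fin n → E) : deviation v ≤ 2 * ∑ i, ‖v i‖ := by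
  rcases Nat.eq_zero_or_pos n with rfl | hn
  · simp [deviation]
  have hn' : (n : ℝ) ≠ 0 := by positivity
  calc deviation v ≤ ∑ i, (‖v i‖ + ‖mean v‖) := Finset.sum_le_sum fun i _ => norm_sub_le _ _
    _ = ∑ i, ‖v i‖ + n * ‖mean v‖ := by simp [Finset.sum_add_distrib]
    _ ≤ ∑ i, ‖v i‖ + n * ((1 / (n : ℝ)) * ∑ i, ‖v i‖) := by gcongr; exact norm_mean_le v
    _ = 2 * ∑ i, ‖v i‖ := by field_simp; ring

lemma sum_sub_mean (v : Fin n → E) : ∑ i, (v i - mean v) = 0 := by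
  rcases Nat.eq_zero_or_pos n with rfl | hn
  · simp
  have hn' : (n : ℝ) ≠ 0 := by positivity
  rw [Finset.sum_sub_distrib, Finset.sum_const, Finset.card_univ, Fintype.card_fin, mean,
    ← Nat.cast_smul_eq_nsmul ℝ, smul_smul, mul_one_div_cancel hn', one_smul, sub_self]

lemma mean_mix {M : Matrix (Fin n) (Fin n) ℝ} (hM : M ∈ doublyStochastic ℝ (Fin n))
    (v : Fin n → E) : mean (mix M v) = mean v := by
  unfold mean mix
  rw [Finset.sum_comm]
  simp_rw [← Finset.sum_smul]
  simp [(mem_doublyStochastic_iff_sum.1 hM).2.2]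

lemma mix_sub_const {M : Matrix (Fin n) (Fin n) ℝ} (hM : M ∈ doublyStochastic ℝ (Fin n))
    (v : Fin n → E) (a : E) (i : Fin n) : mix M v i - a = ∑ j, M i j • (v j - a) := by
  simp_rw [smul_sub, Finset.sum_sub_distrib, ← Finset.sum_smul]
  rw [(mem_doublyStochastic_iff_sum.1 hM).2.1 i, one_smul]
  rfl

/-- The differences to the mean sum to zero, so `η` may be subtracted from every entry without
changing the mixed differences. The reduced entries are still nonnegative and their columns sum to
`1 - n * η`, which is the contraction factor in this `ℓ¹`-type measure. -/
lemma deviation_mix_le {M : Matrix (Fin n) (Fin n) ℝ} (hM : M ∈ doublyStochastic ℝ (Fin n))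
    {η : ℝ} (hη : ∀ i j, η ≤ M i j) (v : Fin n → E) :
    deviation (mix M v) ≤ (1 - n * η) * deviation v := by
  have h1 : ∀ i, mix M v i - mean v = ∑ j, (M i j - η) • (v j - mean v) := fun i => by
    simp_rw [mix_sub_const hM, sub_smul, Finset.sum_sub_distrib, ← Finset.smul_sum,
      sum_sub_mean, smul_zero, sub_zero]
  calc deviation (mix M v) = ∑ i, ‖∑ j, (M i j - η) • (v j - mean v)‖ := by
        unfold deviation; simp_rw [mean_mix hM, h1]
    _ ≤ ∑ i, ∑ j, (M i j - η) * ‖v j - mean v‖ := by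
        refine Finset.sum_le_sum fun i _ => (norm_sum_le _ _).trans_eq ?_
        refine Finset.sum_congr rfl fun j _ => ?_
        rw [norm_smul, Real.norm_of_nonneg (sub_nonneg.2 (hη i j))]
    _ = (1 - n * η) * deviation v := by
        rw [Finset.sum_comm]
        simp_rw [← Finset.sum_mul, Finset.sum_sub_distrib, (mem_doublyStochastic_iff_sum.1 hM).2.2]
        simp [deviation, Finset.mul_sum]

lemma deviation_mix_le_self {M : Matrix (Fin n) (Fin n) ℝ}
    (hM : M ∈ doublyStochastic ℝ (Fin n)) (v : Fin n → E) :
    deviation (mix M v) ≤ deviation v := by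
  simpa using deviation_mix_le hM (η := 0) (fun i j => (mem_doublyStochastic_iff_sum.1 hM).1 i j) v

lemma mix_mul (M N : Matrix (Fin n) (Fin n) ℝ) (v : Fin n → E) :
    mix (M * N) v = mix M (mix N v) := by
  ext i
  simp_rw [mix, Finset.smul_sum, Matrix.mul_apply, Finset.sum_smul, smul_smul]
  exact Finset.sum_comm

lemma mix_add (M : Matrix (Fin n) (Fin n) ℝ) (u v : Fin n → E) :
    mix M (u + v) = mix M u + mix M v := by
  ext i; simp [mix, Finset.sum_add_distrib]

/-- The product `W (t + s - 1) ⋯ W t`. -/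
noncomputable def transition (W : ℕ → Matrix (Fin n) (Fin n) ℝ) (t : ℕ) :
    ℕ → Matrix (Fin n) (Fin n) ℝ
  | 0 => 1
  | s + 1 => W (t + s) * transition W t s

variable {W : ℕ → Matrix (Fin n) (Fin n) ℝ}

lemma transition_mem (hW : ∀ t, 1 ≤ t → W t ∈ doublyStochastic ℝ (Fin n)) {t : ℕ} (ht : 1 ≤ t)
    (s : ℕ) : transition W t s ∈ doublyStochastic ℝ (Fin n) := by
  induction s with
  | zero => exact one_mem _
  | succ s ih => exact mul_mem (hW _ (by omega)) ih

/-- A perturbed averaging iteration stays close to the unperturbed one. -/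
lemma deviation_sub_transition_le (hW : ∀ t, 1 ≤ t → W t ∈ doublyStochastic ℝ (Fin n))
    (v : ℕ → Fin n → E) {t : ℕ} (ht : 1 ≤ t) (s : ℕ) :
    ∃ r : Fin n → E, v (t + s) = mix (transition W t s) (v t) + r ∧
      deviation r ≤ ∑ k ∈ Finset.range s,
        2 * ∑ i, ‖v (t + k + 1) i - mix (W (t + k)) (v (t + k)) i‖ := by
  induction s with
  | zero => exact ⟨0, by ext i; simp [transition, mix, Matrix.one_apply], by simp [deviation, mean]⟩
  | succ s ih =>
    obtain ⟨r, hr, hd⟩ := ih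
    -- The old error is mixed once more, which does not increase its deviation, and the new
    -- perturbation is added.
    refine ⟨mix (W (t + s)) r + (v (t + s + 1) - mix (W (t + s)) (v (t + s))), ?_, ?_⟩
    · rw [transition, mix_mul, ← add_assoc t s 1, ← add_assoc, ← mix_add, ← hr]
      abel
    · rw [Finset.sum_range_succ]
      refine (deviation_add_le _ _).trans (add_le_add ?_ ?_)
      · exact (deviation_mix_le_self (hW _ (by omega)) r).trans hd
      · exact deviation_le _

lemma exists_crossing {α : Type*} {r : α → α → Prop} {S : Set α} {a b : α}
    (h : Relation.ReflTransGen r a b) (ha : a ∈ S) (hb : b ∉ S) :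
    ∃ x ∈ S, ∃ y, y ∉ S ∧ r x y := by
  induction h with
  | refl => exact absurd ha hb
  | @tail c d _ hcd ih =>
    by_cases hc : c ∈ S
    · exact ⟨c, hc, d, hb, hcd⟩
    · exact ih hc

variable {p : ℕ} {m : Fin n → ℕ} {P : Problem n p m} {w : ℝ} {B : ℕ}

lemma Problem.RegularNetwork.W_nonneg (hN : P.RegularNetwork w B) {t : ℕ} (ht : 1 ≤ t)
    (i j : Fin n) : 0 ≤ P.W t i j := by
  by_cases h : (P.graph t).Adj j i ∨ i = j
  · exact (hN.weight_pos t ht i j h).le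
  · exact (hN.weight_zero t ht i j h).ge

lemma Problem.RegularNetwork.W_mem (hN : P.RegularNetwork w B) (t : ℕ) (ht : 1 ≤ t) :
    P.W t ∈ doublyStochastic ℝ (Fin n) :=
  mem_doublyStochastic_iff_sum.2 ⟨hN.W_nonneg ht, hN.row_sum t ht, hN.col_sum t ht⟩

lemma Problem.RegularNetwork.le_W (hN : P.RegularNetwork w B) {t : ℕ} (ht : 1 ≤ t)
    {i j : Fin n} (h : (P.graph t).Adj j i ∨ i = j) : w ≤ P.W t i j :=
  hN.weight_lower t ht i j (hN.weight_pos t ht i j h)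

lemma Problem.RegularNetwork.transition_succ_ge (hN : P.RegularNetwork w B) (hw : 0 < w)
    {t : ℕ} (ht : 1 ≤ t) {s : ℕ} {i j k : Fin n} (hk : w ^ s ≤ transition P.W t s k j)
    (h : (P.graph (t + s)).Adj k i ∨ i = k) : w ^ (s + 1) ≤ transition P.W t (s + 1) i j := by
  have hnn := (mem_doublyStochastic_iff_sum.1 (transition_mem hN.W_mem ht s)).1
  rw [transition, Matrix.mul_apply, pow_succ']
  refine (mul_le_mul (hN.le_W (by omega) h) hk (by positivity)
    (hN.W_nonneg (by omega) _ _)).trans ?_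
  exact Finset.single_le_sum (f := fun k => P.W (t + s) i k * transition P.W t s k j)
    (fun k _ => mul_nonneg (hN.W_nonneg (by omega) _ _) (hnn _ _)) (Finset.mem_univ k)

/-- Self-loops carry weight at least `w`, so an index once reached stays reached at the cost of one
factor `w` per round. -/
lemma Problem.RegularNetwork.transition_ge_add (hN : P.RegularNetwork w B) (hw : 0 < w)
    {t : ℕ} (ht : 1 ≤ t) {s : ℕ} {i j : Fin n} (h : w ^ s ≤ transition P.W t s i j) (l : ℕ) :
    w ^ (s + l) ≤ transition P.W t (s + l) i j := by
  induction l with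
  | zero => exact h
  | succ l ih => exact hN.transition_succ_ge hw ht ih (Or.inr rfl)

-- Every window of `B` rounds enlarges the set of agents reached from `j` by at least one until it
-- is everything: the union graph is strongly connected, so some edge leaves the set during the
-- window. After `n` windows all agents are reached, which bounds every entry of the product below.
open Classical in
lemma Problem.RegularNetwork.card_reached (hN : P.RegularNetwork w B) (hw : 0 < w)
    {t : ℕ} (ht : 1 ≤ t) (j : Fin n) (k : ℕ) :
    min n k ≤ (Finset.univ.filter
      fun i => w ^ (k * B) ≤ transition P.W t (k * B) i j).card := by
  induction k with
  | zero => simp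
  | succ k ih =>
    set S := Finset.univ.filter fun i => w ^ (k * B) ≤ transition P.W t (k * B) i j with hS
    set S' := Finset.univ.filter
      fun i => w ^ ((k + 1) * B) ≤ transition P.W t ((k + 1) * B) i j with hS'
    have hsub : S ⊆ S' := fun i hi => by
      simp only [hS, hS', Finset.mem_filter, Finset.mem_univ, true_and] at hi ⊢
      rw [add_mul, one_mul]
      exact hN.transition_ge_add hw ht hi B
    by_cases hu : S = Finset.univ
    · have : S' = Finset.univ := Finset.univ_subset_iff.1 (hu ▸ hsub)
      rw [this]; simp
    have hj : j ∈ S := by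
      have h0 : w ^ 0 ≤ transition P.W t 0 j j := by simp [transition]
      have := hN.transition_ge_add hw ht h0 (k * B)
      rw [zero_add] at this
      simpa [hS] using this
    obtain ⟨b, hb⟩ : ∃ b, b ∉ S := by
      by_contra! h
      exact hu (Finset.eq_univ_iff_forall.2 h)
    obtain ⟨x, hx, y, hy, l, hl, hadj⟩ := exists_crossing (S := {i | i ∈ S})
      (hN.jointly_connected (t + k * B) (by omega) j b) hj hb
    have hyS' : y ∈ S' := by
      have hx' : w ^ (k * B) ≤ transition P.W t (k * B) x j := by
        simpa [hS] using hx
      -- The weight waits at `x` for `l` rounds, crosses to `y`, and waits there for the remaining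
      -- `B - (l + 1)` rounds of the window.
      have h1 := hN.transition_ge_add hw ht hx' l
      rw [add_assoc] at hadj
      have h2 := hN.transition_ge_add hw ht (hN.transition_succ_ge hw ht h1 (Or.inl hadj))
        (B - (l + 1))
      have h3 : k * B + l + 1 + (B - (l + 1)) = (k + 1) * B := by
        rw [add_mul]; omega
      rw [h3] at h2
      simpa [hS'] using h2
    have hlt : S.card < S'.card :=
      Finset.card_lt_card ⟨hsub, fun h => hy (h hyS')⟩
    omega

lemma Problem.RegularNetwork.transition_ge (hN : P.RegularNetwork w B) (hw : 0 < w)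
    {t : ℕ} (ht : 1 ≤ t) (i j : Fin n) : w ^ (n * B) ≤ transition P.W t (n * B) i j := by
  classical
  have h := hN.card_reached hw ht j n
  rw [min_self] at h
  have hu := (Finset.card_eq_iff_eq_univ (Finset.univ.filter
    fun i => w ^ (n * B) ≤ transition P.W t (n * B) i j)).1
    (le_antisymm (Finset.card_le_univ _) (by simpa using h))
  simpa using (Finset.eq_univ_iff_forall.1 hu) i

/-- The `L`-step recursion is summed over `t`: the first `L` terms, which have no predecessor, are
bounded by `D₀`, and each `e t` occurs in at most `L` windows. -/
lemma sum_le_of_contraction {D e : ℕ → ℝ} {ρ D₀ : ℝ} {L T : ℕ} (hD : ∀ t, 0 ≤ D t)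
    (he : ∀ t, 0 ≤ e t) (hρ : 0 ≤ ρ) (hD₀ : ∀ t, 1 ≤ t → t ≤ T → D t ≤ D₀)
    (hD₀' : 0 ≤ D₀)
    (h : ∀ t, 1 ≤ t → t + L ≤ T → D (t + L) ≤ ρ * D t + ∑ k ∈ Finset.range L, e (t + k)) :
    (1 - ρ) * ∑ t ∈ Finset.Icc 1 T, D t ≤ L * D₀ + L * ∑ t ∈ Finset.Ico 1 T, e t := by
  have hS : 0 ≤ ∑ t ∈ Finset.Icc 1 T, D t := Finset.sum_nonneg fun t _ => hD t
  have hE : 0 ≤ ∑ t ∈ Finset.Ico 1 T, e t := Finset.sum_nonneg fun t _ => he t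
  suffices ∑ t ∈ Finset.Icc 1 T, D t ≤
      L * D₀ + (ρ * ∑ t ∈ Finset.Icc 1 T, D t + L * ∑ t ∈ Finset.Ico 1 T, e t) by linarith
  have hsplit : ∑ t ∈ Finset.Icc 1 T, D t ≤ ∑ t ∈ Finset.Icc 1 (min L T), D t +
      ∑ t ∈ Finset.Icc 1 (T - L), D (t + L) := by
    have h1 : Finset.Icc 1 T = Finset.Icc 1 (min L T) ∪ (Finset.Icc 1 (T - L)).image (· + L) := by
      ext t
      simp only [Finset.mem_union, Finset.mem_image, Finset.mem_Icc]
      constructor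
      · intro ht
        by_cases h : t ≤ L
        · exact Or.inl (by omega)
        · exact Or.inr ⟨t - L, by omega, by omega⟩
      · rintro (h | ⟨a, h1, h2⟩) <;> omega
    rw [h1, Finset.sum_union, Finset.sum_image]
    · exact fun a _ b _ hab => by simpa using hab
    · rw [Finset.disjoint_left]
      intro t
      simp only [Finset.mem_image, Finset.mem_Icc]
      rintro h ⟨a, h1, h2⟩
      omega
  refine hsplit.trans (add_le_add ?_ ?_)
  · calc ∑ t ∈ Finset.Icc 1 (min L T), D t ≤ ∑ t ∈ Finset.Icc 1 (min L T), D₀ := by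
          refine Finset.sum_le_sum fun t ht => ?_
          rw [Finset.mem_Icc] at ht
          exact hD₀ t ht.1 (by omega)
      _ = (min L T : ℕ) * D₀ := by simp
      _ ≤ L * D₀ := by gcongr; exact min_le_left _ _
  · calc ∑ t ∈ Finset.Icc 1 (T - L), D (t + L)
        ≤ ∑ t ∈ Finset.Icc 1 (T - L), (ρ * D t + ∑ k ∈ Finset.range L, e (t + k)) := by
          refine Finset.sum_le_sum fun t ht => ?_
          rw [Finset.mem_Icc] at ht
          exact h t ht.1 (by omega)
      _ = ρ * ∑ t ∈ Finset.Icc 1 (T - L), D t +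
            ∑ k ∈ Finset.range L, ∑ t ∈ Finset.Icc 1 (T - L), e (t + k) := by
          rw [Finset.sum_add_distrib, Finset.mul_sum, Finset.sum_comm]
      _ ≤ ρ * ∑ t ∈ Finset.Icc 1 T, D t +
            ∑ k ∈ Finset.range L, ∑ t ∈ Finset.Ico 1 T, e t := by
          refine add_le_add (mul_le_mul_of_nonneg_left ?_ hρ) (Finset.sum_le_sum fun k hk => ?_)
          · exact Finset.sum_le_sum_of_subset_of_nonneg
              (Finset.Icc_subset_Icc_right (by omega)) fun t _ _ => hD t
          · rw [← Finset.sum_image (s := Finset.Icc 1 (T - L)) (g := (· + k)) (f := e)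
              (fun a _ b _ hab => by simpa using hab)]
            refine Finset.sum_le_sum_of_subset_of_nonneg ?_ fun t _ _ => he t
            intro t
            simp only [Finset.mem_image, Finset.mem_Icc, Finset.mem_Ico, Finset.mem_range] at hk ⊢
            rintro ⟨a, h1, h2⟩
            omega
      _ = ρ * ∑ t ∈ Finset.Icc 1 T, D t + L * ∑ t ∈ Finset.Ico 1 T, e t := by simp

/-- The total deviation of a perturbed averaging iteration over a jointly connected network is
controlled by the total size of the perturbations. -/
lemma Problem.RegularNetwork.sum_deviation_le (hN : P.RegularNetwork w B) (hw : 0 < w)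
    {R : ℝ} (hR : 0 ≤ R) {T : ℕ} (v : ℕ → Fin n → E)
    (hv : ∀ t, 1 ≤ t → t ≤ T → ∀ i, ‖v t i‖ ≤ R) :
    n * w ^ (n * B) * ∑ t ∈ Finset.Icc 1 T, deviation (v t) ≤
      2 * (n * B : ℕ) * (n * R +
        ∑ t ∈ Finset.Ico 1 T, ∑ i, ‖v (t + 1) i - mix (P.W t) (v t) i‖) := by
  rcases Nat.eq_zero_or_pos n with rfl | hn
  · simp
  -- A row of the product sums to one and has `n` entries of size at least `w ^ (n * B)`.
  have hρ : 0 ≤ 1 - n * w ^ (n * B) := by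
    have hM := transition_mem hN.W_mem le_rfl (n * B)
    have h1 := (mem_doublyStochastic_iff_sum.1 hM).2.1 ⟨0, hn⟩
    have h2 : ∑ j : Fin n, w ^ (n * B) ≤ ∑ j, transition P.W 1 (n * B) ⟨0, hn⟩ j :=
      Finset.sum_le_sum fun j _ => hN.transition_ge hw le_rfl _ _
    simp only [Finset.sum_const, Finset.card_univ, Fintype.card_fin, nsmul_eq_mul] at h2
    linarith
  have key := sum_le_of_contraction (D := fun t => deviation (v t))
    (e := fun t => 2 * ∑ i, ‖v (t + 1) i - mix (P.W t) (v t) i‖)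
    (ρ := 1 - n * w ^ (n * B)) (D₀ := 2 * (n * R)) (L := n * B) (T := T)
    (fun t => deviation_nonneg _) (fun t => by positivity) hρ ?_ (by positivity) ?_
  · rw [← Finset.mul_sum] at key
    linarith
  · intro t h1 h2
    refine (deviation_le _).trans ?_
    gcongr
    exact (Finset.sum_le_sum fun i _ => hv t h1 h2 i).trans_eq (by simp)
  · intro t h1 h2
    obtain ⟨r, hr, hd⟩ := deviation_sub_transition_le hN.W_mem v h1 (n * B)
    simp only [hr]
    refine (deviation_add_le _ _).trans (add_le_add ?_ hd)
    exact deviation_mix_le (transition_mem hN.W_mem h1 _) (hN.transition_ge hw h1) _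

end Consensus

end EventTriggered

namespace EventTriggered

/-! ### Sums and monotonicity of the step sizes -/

section StepSizes

/-- Bernoulli's inequality for the concave power `1 - s` plays the role of the integral comparison:
each increment of the right-hand side dominates the next summand. -/
lemma sum_one_div_rpow_le {s : ℝ} (hs₀ : 0 < s) (hs₁ : s < 1) (T : ℕ) :
    ∑ t ∈ Finset.Icc 1 T, 1 / (t : ℝ) ^ s ≤ (T : ℝ) ^ (1 - s) / (1 - s) := by
  induction T with
  | zero => simp [Real.zero_rpow (sub_pos.2 hs₁).ne']
  | succ T ih =>
    rw [Finset.sum_Icc_succ_top (by omega)]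
    have hs : 0 < 1 - s := sub_pos.2 hs₁
    have hT : (0 : ℝ) < (T : ℝ) + 1 := by positivity
    have h1 := rpow_one_add_le_one_add_mul_self (s := -(1 / ((T : ℝ) + 1)))
      (by rw [neg_le_neg_iff, div_le_one hT]; linarith [T.cast_nonneg (α := ℝ)]) hs.le
      (by linarith : 1 - s ≤ 1)
    have h2 : (T : ℝ) = (T + 1) * (1 + -(1 / ((T : ℝ) + 1))) := by field_simp; ring
    have h3 : (0 : ℝ) ≤ 1 + -(1 / ((T : ℝ) + 1)) := by
      have : 1 / ((T : ℝ) + 1) ≤ 1 := by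
        rw [div_le_one hT]; linarith [T.cast_nonneg (α := ℝ)]
      linarith
    have h4 : (T : ℝ) ^ (1 - s) ≤
        ((T : ℝ) + 1) ^ (1 - s) - (1 - s) * (1 / ((T : ℝ) + 1) ^ s) := by
      calc (T : ℝ) ^ (1 - s) = ((T : ℝ) + 1) ^ (1 - s) * (1 + -(1 / ((T : ℝ) + 1))) ^ (1 - s) := by
            rw [← Real.mul_rpow hT.le h3, ← h2]
        _ ≤ ((T : ℝ) + 1) ^ (1 - s) * (1 + (1 - s) * -(1 / ((T : ℝ) + 1))) := by gcongr
        _ = _ := by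
            rw [Real.rpow_sub hT, Real.rpow_one]
            have : 0 < ((T : ℝ) + 1) ^ s := by positivity
            field_simp
            ring
    push_cast
    have h5 : (T : ℝ) ^ (1 - s) / (1 - s) ≤
        ((T : ℝ) + 1) ^ (1 - s) / (1 - s) - 1 / ((T : ℝ) + 1) ^ s := by
      rw [div_le_iff₀ hs, sub_mul, div_mul_cancel₀ _ hs.ne']
      linarith
    linarith

lemma sum_shift_le {u : ℕ → ℝ} (hu : ∀ t, 0 ≤ u t) (T : ℕ) :
    ∑ t ∈ Finset.Ico 1 T, u (t + 1) ≤ ∑ t ∈ Finset.Icc 1 T, u t := by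
  rw [Finset.sum_Ico_add' u 1 T 1]
  refine Finset.sum_le_sum_of_subset_of_nonneg (fun t ht => ?_) fun t _ _ => hu t
  simp only [Finset.mem_Ico, Finset.mem_Icc] at ht ⊢
  omega

variable {c : ℝ}

lemma geomThreshold_pos (hc : 1 < c) (t : ℕ) : 0 < geomThreshold c t := by
  unfold geomThreshold; positivity

lemma geomThreshold_succ_le (hc : 1 < c) (t : ℕ) :
    geomThreshold c (t + 1) ≤ geomThreshold c t := by
  unfold geomThreshold
  exact one_div_le_one_div_of_le (by positivity) (pow_le_pow_right₀ hc.le (Nat.le_succ t))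

lemma sum_geomThreshold_le (hc : 1 < c) (T : ℕ) :
    ∑ t ∈ Finset.Icc 1 T, geomThreshold c t ≤ 1 / (c - 1) := by
  have h : ∑ t ∈ Finset.Icc 1 T, geomThreshold c t = (1 - 1 / c ^ T) / (c - 1) := by
    have hc' : c - 1 ≠ 0 := by linarith
    have hc0 : c ≠ 0 := by linarith
    induction T with
    | zero => simp
    | succ T ih =>
      rw [Finset.sum_Icc_succ_top (by omega), ih, geomThreshold, pow_succ]
      field_simp
      ring
  rw [h]
  have h1 : 0 ≤ 1 / c ^ T := by positivity
  have : 0 < c - 1 := by linarith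
  gcongr
  linarith

lemma le_sum_geomThreshold (hc : 1 < c) {T : ℕ} (hT : 1 ≤ T) :
    1 / c ≤ ∑ t ∈ Finset.Icc 1 T, geomThreshold c t := by
  have := Finset.single_le_sum (f := geomThreshold c)
    (fun t _ => (geomThreshold_pos hc t).le) (Finset.mem_Icc.2 ⟨le_rfl, hT⟩)
  simpa [geomThreshold] using this

/-- The thresholds decrease, so the next one is below the running average. This is what makes `Ψ_t /
t`, and with it `α_t`, nonincreasing. -/
lemma mul_geomThreshold_le_sum (hc : 1 < c) (T : ℕ) :
    T * geomThreshold c (T + 1) ≤ ∑ t ∈ Finset.Icc 1 T, geomThreshold c t := by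
  have h : Antitone (geomThreshold c) := antitone_nat_of_succ_le (geomThreshold_succ_le hc)
  have := Finset.card_nsmul_le_sum (Finset.Icc 1 T) (geomThreshold c) (geomThreshold c (T + 1))
    fun t ht => h (by rw [Finset.mem_Icc] at ht; omega)
  simpa using this

lemma stepAlpha_pos (hc : 1 < c) {t : ℕ} (ht : 1 ≤ t) :
    0 < stepAlpha (geomThreshold c) t := by
  have h := le_sum_geomThreshold hc ht
  have h' : 0 < 1 / c := by positivity
  have ht' : (0 : ℝ) < t := by exact_mod_cast ht
  exact Real.sqrt_pos.2 (div_pos (h'.trans_le h) ht')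

lemma stepAlpha_succ_le (hc : 1 < c) {t : ℕ} (ht : 1 ≤ t) :
    stepAlpha (geomThreshold c) (t + 1) ≤ stepAlpha (geomThreshold c) t := by
  have ht' : (0 : ℝ) < t := by exact_mod_cast ht
  refine Real.sqrt_le_sqrt ?_
  rw [Finset.sum_Icc_succ_top (by omega), div_le_div_iff₀ (by positivity) ht']
  push_cast
  nlinarith [mul_geomThreshold_le_sum hc t]

lemma stepAlpha_le (hc : 1 < c) (t : ℕ) :
    stepAlpha (geomThreshold c) t ≤ √(1 / (c - 1)) * (1 / (t : ℝ) ^ (1 / 2 : ℝ)) := by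
  rw [stepAlpha, Real.sqrt_div' _ t.cast_nonneg, ← Real.sqrt_eq_rpow, mul_one_div]
  gcongr
  exact sum_geomThreshold_le hc t

/-- The first threshold alone gives `Ψ_t ≥ 1/c`. -/
lemma one_div_stepAlpha_le (hc : 1 < c) {t : ℕ} (ht : 1 ≤ t) :
    1 / stepAlpha (geomThreshold c) t ≤ √c * (t : ℝ) ^ (1 / 2 : ℝ) := by
  have ht' : (0 : ℝ) < t := by exact_mod_cast ht
  have hc0 : 0 < c := by linarith
  rw [← Real.sqrt_eq_rpow, ← Real.sqrt_mul hc0.le, div_le_iff₀ (stepAlpha_pos hc ht), stepAlpha,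
    ← Real.sqrt_mul (by positivity)]
  refine Real.one_le_sqrt.2 ?_
  have h := le_sum_geomThreshold hc ht
  rw [div_le_iff₀ hc0] at h
  have h2 : c * t * ((∑ s ∈ Finset.Icc 1 t, geomThreshold c s) / t) =
    (∑ s ∈ Finset.Icc 1 t, geomThreshold c s) * c := by field_simp
  rw [h2]; exact h

lemma sum_stepAlpha_le (hc : 1 < c) (T : ℕ) :
    ∑ t ∈ Finset.Ico 1 T, stepAlpha (geomThreshold c) (t + 1) ≤
      2 * √(1 / (c - 1)) * (T : ℝ) ^ (1 / 2 : ℝ) := by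
  refine (sum_shift_le (u := stepAlpha (geomThreshold c)) (fun t => Real.sqrt_nonneg _) T).trans ?_
  refine (Finset.sum_le_sum fun t _ => stepAlpha_le hc t).trans ?_
  rw [← Finset.mul_sum]
  have := sum_one_div_rpow_le (s := 1 / 2) (by norm_num) (by norm_num) T
  calc _ ≤ √(1 / (c - 1)) * ((T : ℝ) ^ (1 - 1 / 2 : ℝ) / (1 - 1 / 2)) := by gcongr
    _ = _ := by norm_num; ring

variable {κ : ℝ}

lemma stepBeta_pos {t : ℕ} (ht : 1 ≤ t) : 0 < stepBeta κ t := by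
  have ht' : (0 : ℝ) < t := by exact_mod_cast ht
  unfold stepBeta; positivity

lemma regGamma_pos {t : ℕ} (ht : 1 ≤ t) : 0 < regGamma κ t := by
  have ht' : (0 : ℝ) < t := by exact_mod_cast ht
  unfold regGamma; positivity

lemma stepBeta_mul_regGamma {t : ℕ} (ht : 1 ≤ t) : stepBeta κ t * regGamma κ t = 1 / t := by
  have ht' : (0 : ℝ) < t := by exact_mod_cast ht
  unfold stepBeta regGamma
  rw [one_div_mul_one_div, ← Real.rpow_add ht']
  simp

lemma stepBeta_succ_le (hκ : 0 < κ) {t : ℕ} (ht : 1 ≤ t) : stepBeta κ (t + 1) ≤ stepBeta κ t := by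
  have ht' : (0 : ℝ) < t := by exact_mod_cast ht
  unfold stepBeta
  push_cast
  gcongr
  linarith

lemma sum_stepBeta_le (hκ₀ : 0 < κ) (hκ₁ : κ < 1) (T : ℕ) :
    ∑ t ∈ Finset.Ico 1 T, stepBeta κ (t + 1) ≤ (T : ℝ) ^ (1 - κ) / (1 - κ) :=
  (sum_shift_le (u := stepBeta κ) (fun t => by unfold stepBeta; positivity) T).trans
    (sum_one_div_rpow_le hκ₀ hκ₁ T)

lemma sum_regGamma_le (hκ₀ : 0 < κ) (hκ₁ : κ < 1) (T : ℕ) :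
    ∑ t ∈ Finset.Ico 1 T, regGamma κ (t + 1) ≤ (T : ℝ) ^ κ / κ := by
  have h := (sum_shift_le (u := regGamma κ) (fun t => by unfold regGamma; positivity) T).trans
    (sum_one_div_rpow_le (sub_pos.2 hκ₁) (by linarith) T)
  simpa using h

/-- `1/γ_{t+1} - β_{t+1} ≤ 1/γ_t`. -/
lemma one_sub_div_regGamma_succ_le (hκ₀ : 0 < κ) {t : ℕ} (ht : 1 ≤ t) :
    (1 - stepBeta κ (t + 1) * regGamma κ (t + 1)) / regGamma κ (t + 1) ≤ 1 / regGamma κ t := by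
  have ht' : (0 : ℝ) < t := by exact_mod_cast ht
  rw [stepBeta_mul_regGamma (by omega)]
  unfold regGamma
  push_cast
  rw [one_div_one_div, div_div_eq_mul_div, div_one, Real.rpow_sub ht', Real.rpow_sub (by positivity),
    Real.rpow_one, Real.rpow_one]
  have h : (1 - 1 / ((t : ℝ) + 1)) * (((t : ℝ) + 1) / ((t : ℝ) + 1) ^ κ) =
      t / ((t : ℝ) + 1) ^ κ := by field_simp; ring
  rw [h]
  gcongr
  linarith

/-- Summation by parts against an increasing weight. -/
lemma sum_weighted_telescope_le {a d : ℕ → ℝ} {M : ℝ} (hd₀ : ∀ t, 0 ≤ d t)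
    {T : ℕ} (hT : 1 ≤ T) (hd : ∀ t, 1 ≤ t → t ≤ T → d t ≤ M)
    (ha₀ : 0 ≤ a 1) (ha : ∀ t, 1 ≤ t → a t ≤ a (t + 1)) :
    ∑ t ∈ Finset.Ico 1 T, a (t + 1) * (d t - d (t + 1)) ≤ a T * M := by
  -- The term `- a T * d T` is kept so that the induction closes; it is dropped only at the end.
  suffices ∑ t ∈ Finset.Ico 1 T, a (t + 1) * (d t - d (t + 1)) ≤ a T * M - a T * d T by
    have hp : 0 ≤ a T := by
      clear this hd
      induction T, hT using Nat.le_induction with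
      | base => exact ha₀
      | succ T hT ih => exact ih.trans (ha T hT)
    nlinarith [hd₀ T]
  induction T, hT using Nat.le_induction with
  | base =>
    have := hd 1 le_rfl le_rfl
    simp only [Finset.Ico_self, Finset.sum_empty]
    nlinarith
  | succ T hT ih =>
    rw [Finset.sum_Ico_succ_top hT]
    have h1 := ih fun t h1 h2 => hd t h1 (by omega)
    have h2 := hd T hT (by omega)
    nlinarith [ha T hT]

end StepSizes

end EventTriggered

namespace EventTriggered

/-! ### The primal-dual inequality for one agent and one round -/

section OneStep

section NonnegPart

variable {ι : Type}

@[simp] lemma nonnegPart_apply (v : EuclideanSpace ℝ ι) (k : ι) :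
    nonnegPart v k = max (v k) 0 := rfl

/-- The vector all of whose coordinates are `r`. -/
noncomputable def constVec (ι : Type) (r : ℝ) : EuclideanSpace ℝ ι := WithLp.toLp 2 fun _ => r

@[simp] lemma constVec_apply (r : ℝ) (k : ι) : constVec ι r k = r := rfl

variable [Fintype ι]

lemma norm_le_of_abs_le {u v : EuclideanSpace ℝ ι} (h : ∀ k, |u k| ≤ v k) : ‖u‖ ≤ ‖v‖ := by
  rw [EuclideanSpace.norm_eq, EuclideanSpace.norm_eq]
  refine Real.sqrt_le_sqrt (Finset.sum_le_sum fun k _ => ?_)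
  rw [Real.norm_eq_abs, Real.norm_eq_abs]
  exact pow_le_pow_left₀ (abs_nonneg _) ((h k).trans (le_abs_self _)) 2

lemma norm_le_norm_of_abs_le {u v : EuclideanSpace ℝ ι} (h : ∀ k, |u k| ≤ |v k|) :
    ‖u‖ ≤ ‖v‖ := by
  rw [EuclideanSpace.norm_eq, EuclideanSpace.norm_eq]
  refine Real.sqrt_le_sqrt (Finset.sum_le_sum fun k _ => ?_)
  rw [Real.norm_eq_abs, Real.norm_eq_abs]
  exact pow_le_pow_left₀ (abs_nonneg _) (h k) 2

lemma norm_nonnegPart_le (v : EuclideanSpace ℝ ι) : ‖nonnegPart v‖ ≤ ‖v‖ :=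
  norm_le_norm_of_abs_le fun k => by
    rw [nonnegPart_apply, abs_of_nonneg (le_max_right _ _)]
    exact max_le (le_abs_self _) (abs_nonneg _)

lemma norm_nonnegPart_sub_le (v : EuclideanSpace ℝ ι) {u : EuclideanSpace ℝ ι}
    (hu : ∀ k, 0 ≤ u k) : ‖nonnegPart v - u‖ ≤ ‖v - u‖ :=
  norm_le_norm_of_abs_le fun k => by
    simp only [PiLp.sub_apply, nonnegPart_apply]
    have := hu k
    rcases le_total (v k) 0 with h | h
    · rw [max_eq_right h, abs_le]
      rw [abs_of_nonpos (by linarith : v k - u k ≤ 0)]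
      constructor <;> linarith
    · rw [max_eq_left h]

lemma inner_nonneg_of_nonneg {u v : EuclideanSpace ℝ ι} (hu : ∀ k, 0 ≤ u k) (hv : ∀ k, 0 ≤ v k) :
    0 ≤ inner ℝ u v := by
  rw [PiLp.inner_apply]
  exact Finset.sum_nonneg fun k _ => by
    simpa using mul_nonneg (hv k) (hu k)

lemma inner_mono_right {u v v' : EuclideanSpace ℝ ι} (hu : ∀ k, 0 ≤ u k) (hv : ∀ k, v k ≤ v' k) :
    inner ℝ u v ≤ inner ℝ u v' := by
  have := inner_nonneg_of_nonneg (u := u) (v := v' - v) hu fun k => by simpa using hv k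
  rw [inner_sub_right] at this
  linarith

lemma norm_le_sum_abs (v : EuclideanSpace ℝ ι) : ‖v‖ ≤ ∑ k, |v k| := by
  rw [EuclideanSpace.norm_eq]
  refine Real.sqrt_le_iff.2 ⟨Finset.sum_nonneg fun _ _ => abs_nonneg _, ?_⟩
  exact Finset.sum_sq_le_sq_sum_of_nonneg fun _ _ => abs_nonneg _

lemma norm_constVec_sq (r : ℝ) : ‖constVec ι r‖ ^ 2 = Fintype.card ι * r ^ 2 := by
  rw [EuclideanSpace.norm_sq_eq]
  simp

lemma norm_constVec_le {r : ℝ} (hr : 0 ≤ r) : ‖constVec ι r‖ ≤ Fintype.card ι * r :=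
  (norm_le_sum_abs _).trans (by simp [abs_of_nonneg hr])

/-- The Euclidean norm is at most the `ℓ¹` norm. A multiplier with equal coordinates therefore
detects the violation without depending on the trajectory. -/
lemma mul_norm_le_inner_constVec {r : ℝ} (hr : 0 ≤ r) {v : EuclideanSpace ℝ ι}
    (hv : ∀ k, 0 ≤ v k) : r * ‖v‖ ≤ inner ℝ (constVec ι r) v := by
  refine (mul_le_mul_of_nonneg_left (norm_le_sum_abs v) hr).trans_eq ?_
  rw [PiLp.inner_apply, Finset.mul_sum]
  refine Finset.sum_congr rfl fun k _ => ?_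
  simp [abs_of_nonneg (hv k), mul_comm]

end NonnegPart

variable {d k : ℕ} {K : Set (Vec d)}

lemma IsProjection.inner_le_zero (hK : Convex ℝ K) {u x : Vec d} (h : IsProjection K u x)
    {y : Vec d} (hy : y ∈ K) : inner ℝ (u - x) (y - x) ≤ 0 := by
  refine (norm_eq_iInf_iff_real_inner_le_zero hK h.1).1 ?_ y hy
  have : Nonempty K := ⟨⟨x, h.1⟩⟩
  refine le_antisymm (le_ciInf fun y => ?_) ?_
  · exact (sq_le_sq₀ (norm_nonneg _) (norm_nonneg _)).1 (h.2 y y.2)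
  · exact ciInf_le (f := fun w : K => ‖u - w‖)
      ⟨0, by rintro _ ⟨w, rfl⟩; exact norm_nonneg _⟩ ⟨x, h.1⟩

/-- The variational inequality of the projection, expanded by the three-point identity. The term
`‖x' - z‖ ^ 2` is retained because it later controls the network errors. -/
lemma IsProjection.step_le (hK : Convex ℝ K) {z ω x' y : Vec d} {α : ℝ}
    (h : IsProjection K (z - α • ω) x') (hy : y ∈ K) :
    2 * α * inner ℝ ω (x' - y) ≤ ‖z - y‖ ^ 2 - ‖x' - y‖ ^ 2 - ‖x' - z‖ ^ 2 := by
  have h1 := h.inner_le_zero hK hy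
  have h2 : z - α • ω - x' = (z - x') - α • ω := by abel
  rw [h2, inner_sub_left, inner_smul_left, ← neg_sub x' y, inner_neg_right, inner_neg_right] at h1
  have h3 : ‖z - y‖ ^ 2 = ‖z - x'‖ ^ 2 + 2 * inner ℝ (z - x') (x' - y) + ‖x' - y‖ ^ 2 := by
    rw [← norm_add_sq_real]; congr 2; abel
  rw [norm_sub_rev x' z]
  simp only [conj_trivial] at h1
  linarith

lemma adjoint_apply_coord (G : Vec k →L[ℝ] Vec d) (v : Vec d) (l : Fin k) :
    ContinuousLinearMap.adjoint G v l = inner ℝ (G (EuclideanSpace.single l 1)) v := by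
  rw [← ContinuousLinearMap.adjoint_inner_right, EuclideanSpace.inner_single_left]
  simp

lemma norm_adjoint_apply_le {F : ℝ} {G : Vec k →L[ℝ] Vec d} (hG : ‖G‖ ≤ F) (v : Vec d) :
    ‖ContinuousLinearMap.adjoint G v‖ ≤ F * ‖v‖ :=
  (ContinuousLinearMap.le_opNorm _ _).trans (by
    rw [LinearIsometryEquiv.norm_map]
    gcongr)

/-- Scaling the columns by `θ` means composing `G` with a diagonal contraction, so the operator norm
does not grow. -/
lemma norm_le_of_columns {G H : Vec k →L[ℝ] Vec d} {F : ℝ} (hG : ‖G‖ ≤ F)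
    (h : ∀ l, ∃ θ ∈ Set.Icc (0 : ℝ) 1,
      H (EuclideanSpace.single l 1) = θ • G (EuclideanSpace.single l 1)) : ‖H‖ ≤ F := by
  choose θ hθ hH using h
  refine ContinuousLinearMap.opNorm_le_bound _ ((norm_nonneg _).trans hG) fun v => ?_
  have expand : ∀ v : Vec k, v = ∑ l, v l • EuclideanSpace.single l (1 : ℝ) := fun v => by
    ext j
    simp [Pi.single_apply]
  have h1 : H v = G (WithLp.toLp 2 fun l => θ l * v l) := by
    rw [expand v, map_sum, expand (WithLp.toLp 2 fun l => θ l * _), map_sum]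
    refine Finset.sum_congr rfl fun l _ => ?_
    rw [← expand v, map_smul, map_smul, hH, smul_smul, mul_comm]
  rw [h1]
  refine (G.le_opNorm _).trans (mul_le_mul hG ?_ (norm_nonneg _) ((norm_nonneg _).trans hG))
  refine norm_le_norm_of_abs_le fun l => ?_
  simp only [abs_mul, abs_of_nonneg (hθ l).1]
  exact mul_le_of_le_one_left (abs_nonneg _) (hθ l).2

variable {f : Vec d → ℝ} {g : Vec d → Vec k} {x x' y z sf : Vec d} {q q' : Vec k}
  {G : Vec k →L[ℝ] Vec d} {F₁ F₂ R α β γ r : ℝ}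

/-- The linearization of `[g]₊` at `x`, evaluated at `x'`. -/
noncomputable def linPos (g : Vec d → Vec k) (G : Vec k →L[ℝ] Vec d) (x x' : Vec d) : Vec k :=
  nonnegPart (g x) + ContinuousLinearMap.adjoint G (x' - x)

lemma linPos_le (hG : IsSubgradientMatrix K (fun y => nonnegPart (g y)) x G) (hx' : x' ∈ K)
    (l : Fin k) : linPos g G x x' l ≤ nonnegPart (g x') l := by
  have := hG l x' hx'
  simpa only [linPos, PiLp.add_apply, adjoint_apply_coord] using this

lemma norm_linPos_le (hGb : ‖G‖ ≤ F₂) (hg : ‖g x‖ ≤ F₁) :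
    ‖linPos g G x x'‖ ≤ F₁ + F₂ * ‖x' - x‖ :=
  (norm_add_le _ _).trans
    (add_le_add ((norm_nonnegPart_le _).trans hg) (norm_adjoint_apply_le hGb _))

/-- The subgradient inequalities at `x` hold coordinatewise and are compared as vectors before
taking norms, so the Lipschitz constant is the operator norm bound `F₂`. -/
lemma norm_nonnegPart_le_add (hG : IsSubgradientMatrix K (fun y => nonnegPart (g y)) x G)
    (hGb : ‖G‖ ≤ F₂) (hy : y ∈ K) :
    ‖nonnegPart (g x)‖ ≤ ‖nonnegPart (g y)‖ + F₂ * ‖x - y‖ := by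
  refine (norm_le_of_abs_le (v := nonnegPart (g y) + ContinuousLinearMap.adjoint G (x - y))
    fun l => ?_).trans ((norm_add_le _ _).trans
      (add_le_add le_rfl (norm_adjoint_apply_le hGb _)))
  have := hG l y hy
  rw [← neg_sub x y, inner_neg_right, ← adjoint_apply_coord] at this
  rw [abs_of_nonneg (by simp), PiLp.add_apply]
  linarith

/-- One step of the dual iteration keeps `β ‖q‖` bounded. -/
lemma norm_dual_step_le (hG : IsSubgradientMatrix K (fun y => nonnegPart (g y)) x G)
    (hx' : x' ∈ K) (hg : ‖g x'‖ ≤ F₁) (hγ : 0 ≤ γ) (hβγ : β * γ ≤ 1) (hq : ∀ l, 0 ≤ q l) :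
    ‖nonnegPart ((1 - β * γ) • q + γ • linPos g G x x')‖ ≤ (1 - β * γ) * ‖q‖ + γ * F₁ := by
  have hs : 0 ≤ 1 - β * γ := by linarith
  refine (norm_le_of_abs_le (v := (1 - β * γ) • q + γ • nonnegPart (g x')) fun l => ?_).trans
    ((norm_add_le _ _).trans ?_)
  · rw [abs_of_nonneg (by simp), nonnegPart_apply]
    refine max_le ?_ ?_
    · simp only [PiLp.add_apply, PiLp.smul_apply, smul_eq_mul]
      gcongr
      exact linPos_le hG hx' l
    · simp only [PiLp.add_apply, PiLp.smul_apply, smul_eq_mul]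
      exact add_nonneg (mul_nonneg hs (hq l)) (mul_nonneg hγ (le_max_right _ _))
  · rw [norm_smul, norm_smul, Real.norm_of_nonneg hs, Real.norm_of_nonneg hγ]
    gcongr
    exact (norm_nonnegPart_le _).trans hg

/-- Projecting onto the orthant brings the iterate no farther from `μ`, so the squared distance can
be expanded along the direction `b - β • q`. Polarizing the regularization term `inner (q - μ) q`
yields the factor `1 - β * γ`, the cost `β / 2 * ‖μ‖ ^ 2`, and a favourable multiple of `‖q‖ ^ 2`
that is discarded. -/
lemma dual_step_sub_le {b μ : Vec k} {C : ℝ} (hγ : 0 < γ) (hβ : 0 ≤ β) (hμ : ∀ l, 0 ≤ μ l)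
    (hb : ‖b - β • q‖ ≤ C) :
    (‖nonnegPart ((1 - β * γ) • q + γ • b) - μ‖ ^ 2 - (1 - β * γ) * ‖q - μ‖ ^ 2) / (2 * γ) ≤
      γ / 2 * C ^ 2 + inner ℝ q b - inner ℝ μ b + β / 2 * ‖μ‖ ^ 2 := by
  have h1 : ‖nonnegPart ((1 - β * γ) • q + γ • b) - μ‖ ^ 2 ≤ ‖(q - μ) + γ • (b - β • q)‖ ^ 2 := by
    refine pow_le_pow_left₀ (norm_nonneg _) ((norm_nonnegPart_sub_le _ hμ).trans_eq ?_) 2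
    congr 1
    module
  have h2 : ‖(q - μ) + γ • (b - β • q)‖ ^ 2 =
      ‖q - μ‖ ^ 2 + 2 * γ * (inner ℝ q b - inner ℝ μ b) - 2 * γ * β * inner ℝ (q - μ) q
        + γ ^ 2 * ‖b - β • q‖ ^ 2 := by
    rw [norm_add_sq_real, norm_smul, mul_pow, Real.norm_eq_abs, sq_abs]
    simp only [inner_smul_right, inner_sub_right, inner_sub_left]
    ring
  have h3 : ‖μ‖ ^ 2 = ‖q‖ ^ 2 - 2 * inner ℝ (q - μ) q + ‖q - μ‖ ^ 2 := by
    have := norm_sub_sq_real q (q - μ)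
    rw [sub_sub_cancel, real_inner_comm] at this
    exact this
  have h4 : ‖b - β • q‖ ^ 2 ≤ C ^ 2 := pow_le_pow_left₀ (norm_nonneg _) hb 2
  rw [div_le_iff₀ (by positivity)]
  have h5 : γ ^ 2 * ‖b - β • q‖ ^ 2 ≤ γ ^ 2 * C ^ 2 := by gcongr
  have h6 : 0 ≤ β * γ * ‖q‖ ^ 2 := by positivity
  have h7 : 2 * γ * β * inner ℝ (q - μ) q =
      β * γ * (‖q‖ ^ 2 + ‖q - μ‖ ^ 2 - ‖μ‖ ^ 2) := by rw [h3]; ring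
  rw [h7] at h2
  linear_combination h1 + h2 + h5 + h6

/-- The basic inequality for one step of one agent. -/
lemma primal_dual_step_le (hK : Convex ℝ K) (hy : y ∈ K)
    (hsf : IsSubgradient K f x sf) (hsfb : ‖sf‖ ≤ F₂)
    (hG : IsSubgradientMatrix K (fun y => nonnegPart (g y)) x G) (hGb : ‖G‖ ≤ F₂)
    (hgb : ‖g x‖ ≤ F₁) (hgy : ∀ l, g y l ≤ 0) (hxx : ‖x' - x‖ ≤ 2 * R)
    (hq : ∀ l, 0 ≤ q l) (hqb : β * ‖q‖ ≤ F₁)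
    (hα : 0 < α) (hβ : 0 ≤ β) (hγ : 0 < γ) (hr : 0 ≤ r)
    (hproj : IsProjection K (z - α • (sf + G q)) x')
    (hq' : q' = nonnegPart ((1 - β * γ) • q + γ • linPos g G x x')) :
    f x - f y + r * ‖nonnegPart (g x)‖ + ‖x' - z‖ ^ 2 / (2 * α) +
        (‖q' - constVec _ r‖ ^ 2 - (1 - β * γ) * ‖q - constVec _ r‖ ^ 2) / (2 * γ) ≤
      γ / 2 * (2 * F₁ + 2 * R * F₂) ^ 2 + β / 2 * (k * r ^ 2) +
        F₂ * (1 + k * r) * ‖x' - x‖ + (‖z - y‖ ^ 2 - ‖x' - y‖ ^ 2) / (2 * α) := by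
  have hF₂ : 0 ≤ F₂ := (norm_nonneg _).trans hGb
  -- One `F₁` comes from the constraint value, the other from `β * ‖q‖`; the slope contributes `F₂`
  -- times the diameter `2 * R`.
  have hb : ‖linPos g G x x' - β • q‖ ≤ 2 * F₁ + 2 * R * F₂ := by
    refine (norm_sub_le _ _).trans ?_
    rw [norm_smul, Real.norm_of_nonneg hβ]
    have h1 := norm_linPos_le (x' := x') hGb hgb
    nlinarith
  have hdual := dual_step_sub_le (q := q) (μ := constVec _ r) hγ hβ (fun l => hr) hb
  rw [norm_constVec_sq, Fintype.card_fin, ← hq'] at hdual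
  have hprim : inner ℝ (sf + G q) (x' - y) ≤
      (‖z - y‖ ^ 2 - ‖x' - y‖ ^ 2) / (2 * α) - ‖x' - z‖ ^ 2 / (2 * α) := by
    rw [← sub_div, le_div_iff₀ (by positivity)]
    linarith [hproj.step_le hK hy]
  have hμ : r * ‖nonnegPart (g x)‖ - F₂ * (k * r) * ‖x' - x‖ ≤
      inner ℝ (constVec _ r) (linPos g G x x') := by
    rw [linPos, inner_add_right]
    have h1 := mul_norm_le_inner_constVec hr (v := nonnegPart (g x)) fun l => by simp
    have h2 := neg_le_of_abs_le (abs_real_inner_le_norm (constVec (Fin k) r)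
      (ContinuousLinearMap.adjoint G (x' - x)))
    have h3 : ‖constVec (Fin k) r‖ * ‖ContinuousLinearMap.adjoint G (x' - x)‖ ≤
        (k * r) * (F₂ * ‖x' - x‖) := by
      gcongr
      · simpa using norm_constVec_le (ι := Fin k) hr
      · exact norm_adjoint_apply_le hGb _
    linarith
  have hin : f x - f y - F₂ * ‖x' - x‖ + inner ℝ q (linPos g G x x') ≤
      inner ℝ (sf + G q) (x' - y) := by
    have h1 := hsf y hy
    have h2 := neg_le_of_abs_le (abs_real_inner_le_norm sf (x' - x))
    have h3 : ‖sf‖ * ‖x' - x‖ ≤ F₂ * ‖x' - x‖ := by gcongr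
    have h4 : inner ℝ q (linPos g G x x') ≤ inner ℝ (G q) (x' - y) := by
      have h5 : inner ℝ q (linPos g G x y) ≤ 0 := by
        refine (inner_mono_right hq (linPos_le hG hy)).trans_eq ?_
        have : nonnegPart (g y) = 0 := by
          ext l; simp [hgy l]
        rw [this, inner_zero_right]
      rw [linPos, inner_add_right, ContinuousLinearMap.adjoint_inner_right] at h5 ⊢
      have h6 : x' - y = (x' - x) - (y - x) := by abel
      rw [h6, inner_sub_right (G q) (x' - x) (y - x)]
      linarith
    have h7 : x' - y = (x' - x) - (y - x) := by abel
    rw [inner_add_left, h7, inner_sub_right sf, ← h7]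
    linarith
  linarith

end OneStep

end EventTriggered

namespace EventTriggered

/-! ### Invariants of the iteration and network errors in terms of the primal steps -/

section Trajectories

variable {n p : ℕ} {m : Fin n → ℕ} {P : Problem n p m} {F₁ F₂ R w κ c : ℝ} {B T : ℕ}
  {α β γ τ : ℕ → ℝ} {S : Trajectory n p m}

/-- Row sums equal to one give convexity of the square for each agent; column sums equal to one make
the weights disappear after summing over agents. -/
lemma sum_norm_mix_sub_sq_le {E : Type*} [NormedAddCommGroup E] [NormedSpace ℝ E]
    {M : Matrix (Fin n) (Fin n) ℝ} (hM : M ∈ doublyStochastic ℝ (Fin n)) (v : Fin n → E) (a : E) :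
    ∑ i, ‖mix M v i - a‖ ^ 2 ≤ ∑ j, ‖v j - a‖ ^ 2 := by
  obtain ⟨h0, hr, hc⟩ := mem_doublyStochastic_iff_sum.1 hM
  calc ∑ i, ‖mix M v i - a‖ ^ 2 ≤ ∑ i, ∑ j, M i j * ‖v j - a‖ ^ 2 := by
        refine Finset.sum_le_sum fun i _ => ?_
        refine le_trans ?_ (Real.pow_arith_mean_le_arith_mean_pow Finset.univ (M i)
          (fun j => ‖v j - a‖) (fun j _ => h0 i j) (hr i) (fun j _ => norm_nonneg _) 2)
        rw [mix_sub_const hM]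
        refine pow_le_pow_left₀ (norm_nonneg _) ((norm_sum_le _ _).trans_eq ?_) 2
        refine Finset.sum_congr rfl fun j _ => ?_
        rw [norm_smul, Real.norm_of_nonneg (h0 i j)]
    _ = ∑ j, ‖v j - a‖ ^ 2 := by
        rw [Finset.sum_comm]
        simp_rw [← Finset.sum_mul, hc, one_mul]

lemma Problem.RegularData.norm_sub_le (hD : P.RegularData F₁ F₂ R) {x y : Vec p} (hx : x ∈ P.X)
    (hy : y ∈ P.X) : ‖x - y‖ ≤ 2 * R :=
  (_root_.norm_sub_le _ _).trans (by linarith [hD.bounded x hx, hD.bounded y hy])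

/-- On the decision set, squared distances vary slowly. -/
lemma Problem.RegularData.norm_sub_sq_le (hD : P.RegularData F₁ F₂ R) {x x' y y' : Vec p}
    (hx : x ∈ P.X) (hx' : x' ∈ P.X) (hy : y ∈ P.X) (hy' : y' ∈ P.X) :
    ‖x - y‖ ^ 2 ≤ ‖x' - y'‖ ^ 2 + 4 * R * (‖x - x'‖ + ‖y - y'‖) := by
  have h1 := hD.norm_sub_le hx hy
  have h2 := hD.norm_sub_le hx' hy'
  have h3 : ‖x - y‖ ≤ ‖x' - y'‖ + (‖x - x'‖ + ‖y - y'‖) := by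
    have : x - y = (x' - y') + ((x - x') - (y - y')) := by abel
    rw [this]
    exact (norm_add_le _ _).trans (add_le_add le_rfl (_root_.norm_sub_le _ _))
  have h4 : 0 ≤ ‖x - x'‖ + ‖y - y'‖ := by positivity
  rcases le_total ‖x - y‖ ‖x' - y'‖ with h | h
  · have h5 := pow_le_pow_left₀ (norm_nonneg _) h 2
    have : 0 ≤ R := by linarith [norm_nonneg (x - y)]
    nlinarith [mul_nonneg this h4]
  · nlinarith [norm_nonneg (x - y), norm_nonneg (x' - y')]

lemma Problem.RegularData.norm_subgPos_le (hD : P.RegularData F₁ F₂ R)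
    (hP : P.PosPartSubgradients) {i : Fin n} {t : ℕ} (ht : 1 ≤ t) {x : Vec p} (hx : x ∈ P.X) :
    ‖P.subgPos i t x‖ ≤ F₂ :=
  norm_le_of_columns (hD.subg_bound i t ht x hx) (hP.chain_rule i t ht x hx)

lemma Problem.RegularData.f_le_add (hD : P.RegularData F₁ F₂ R) {i : Fin n} {t : ℕ} (ht : 1 ≤ t)
    {x y : Vec p} (hx : x ∈ P.X) (hy : y ∈ P.X) : P.f i t x ≤ P.f i t y + F₂ * ‖x - y‖ := by
  have h1 := hD.subf_spec i t ht x hx y hy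
  have h2 := neg_le_of_abs_le (abs_real_inner_le_norm (P.subf i t x) (y - x))
  rw [norm_sub_rev y x] at h2
  nlinarith [hD.subf_bound i t ht x hx, norm_nonneg (x - y)]

namespace IsGenerated

lemma x_mem (hS : IsGenerated P α β γ τ T S) (i : Fin n) {t : ℕ} (h1 : 1 ≤ t) (h2 : t ≤ T) :
    S.x i t ∈ P.X := by
  obtain ⟨t, rfl⟩ := Nat.exists_eq_add_of_le' h1
  rcases Nat.eq_zero_or_pos t with rfl | ht
  · exact hS.init_x i
  · exact (hS.step_x i t ht (by omega)).1

lemma xhat_mem (hS : IsGenerated P α β γ τ T S) (i : Fin n) {t : ℕ} (h1 : 1 ≤ t) (h2 : t ≤ T) :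
    S.xhat i t ∈ P.X := by
  induction t, h1 using Nat.le_induction with
  | base => exact hS.init_xhat i ▸ hS.init_x i
  | succ t h1 ih =>
    rw [hS.step_xhat i t h1 (by omega)]
    split_ifs
    · exact hS.x_mem i (by omega) h2
    · exact ih (by omega)

lemma norm_xhat_sub_x_le (hS : IsGenerated P α β γ τ T S) (hτ : ∀ t, 0 ≤ τ t) (i : Fin n) {t : ℕ}
    (h1 : 1 ≤ t) (h2 : t ≤ T) : ‖S.xhat i t - S.x i t‖ ≤ τ t := by
  obtain ⟨t, rfl⟩ := Nat.exists_eq_add_of_le' h1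
  rcases Nat.eq_zero_or_pos t with rfl | ht
  · simpa [hS.init_xhat i] using hτ 1
  · rw [hS.step_xhat i t ht (by omega)]
    split_ifs with h
    · simpa using hτ (t + 1)
    · rw [norm_sub_rev]
      exact (not_le.1 h).le

lemma q_nonneg (hS : IsGenerated P α β γ τ T S) (i : Fin n) {t : ℕ} (h1 : 1 ≤ t) (h2 : t ≤ T)
    (l : Fin (m i)) : 0 ≤ S.q i t l := by
  obtain ⟨t, rfl⟩ := Nat.exists_eq_add_of_le' h1
  rcases Nat.eq_zero_or_pos t with rfl | ht
  · simp [hS.init_q i]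
  · simp [hS.step_q i t ht (by omega)]

/-- The bound is invariant: since `β` decreases, multiplying the dual step estimate by `β` gives the
convex combination `(1 - βγ) F₁ + βγ F₁`. -/
lemma stepBeta_mul_norm_q_le (hD : P.RegularData F₁ F₂ R) (hP : P.PosPartSubgradients)
    (hF₁ : 0 ≤ F₁) (hκ : 0 < κ)
    (hS : IsGenerated P α (stepBeta κ) (regGamma κ) τ T S) (i : Fin n) {t : ℕ}
    (h1 : 1 ≤ t) (h2 : t ≤ T) : stepBeta κ t * ‖S.q i t‖ ≤ F₁ := by
  induction t, h1 using Nat.le_induction with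
  | base => simpa [hS.init_q i] using hF₁
  | succ t h1 ih =>
    have hx := hS.x_mem i h1 (by omega)
    have hx' := hS.x_mem i (t := t + 1) (by omega) h2
    have hγ := regGamma_pos (κ := κ) (t := t + 1) (by omega)
    have hβ := stepBeta_pos (κ := κ) (t := t + 1) (by omega)
    have hβγ : stepBeta κ (t + 1) * regGamma κ (t + 1) ≤ 1 := by
      rw [stepBeta_mul_regGamma (by omega), div_le_one (by positivity)]
      exact_mod_cast h1.trans (Nat.le_succ t)
    have h := norm_dual_step_le (hP.isSubgradient i t h1 _ hx) hx' (hD.g_bound i t h1 _ hx')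
      hγ.le hβγ (hS.q_nonneg i h1 (by omega))
    rw [linPos, ← hS.step_q i t h1 (by omega)] at h
    have h3 : stepBeta κ (t + 1) * ‖S.q i t‖ ≤ F₁ :=
      (mul_le_mul_of_nonneg_right (stepBeta_succ_le hκ h1) (norm_nonneg _)).trans (ih (by omega))
    have h4 := mul_le_mul_of_nonneg_left h hβ.le
    have h5 := mul_le_mul_of_nonneg_left h3 (sub_nonneg.2 hβγ)
    linarith

end IsGenerated

/-- The sum of the lengths of all primal steps. -/
noncomputable def totalStep (S : Trajectory n p m) (T : ℕ) : ℝ :=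
  ∑ t ∈ Finset.Ico 1 T, ∑ i, ‖S.x i (t + 1) - S.z i (t + 1)‖

/-- The sum of the squared lengths of all primal steps, weighted by the inverse step sizes. -/
noncomputable def stepEnergy (α : ℕ → ℝ) (S : Trajectory n p m) (T : ℕ) : ℝ :=
  ∑ t ∈ Finset.Ico 1 T, ∑ i, ‖S.x i (t + 1) - S.z i (t + 1)‖ ^ 2 / α (t + 1)

/-- The sum of all pairwise distances between the decisions of the agents. -/
noncomputable def disagreement (S : Trajectory n p m) (T : ℕ) : ℝ :=
  ∑ t ∈ Finset.Icc 1 T, ∑ i, ∑ j, ‖S.x i t - S.x j t‖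

/-- The total distance travelled by the decisions. -/
noncomputable def totalMovement (S : Trajectory n p m) (T : ℕ) : ℝ :=
  ∑ t ∈ Finset.Ico 1 T, ∑ i, ‖S.x i (t + 1) - S.x i t‖

/-- The regret of the agents with respect to their own losses, before the last round. -/
noncomputable def localRegret (P : Problem n p m) (S : Trajectory n p m) (T : ℕ)
    (y : ℕ → Vec p) : ℝ :=
  ∑ t ∈ Finset.Ico 1 T, ∑ i, (P.f i t (S.x i t) - P.f i t (y t))

/-- The violation by the agents of their own constraints, before the last round. -/
noncomputable def localViolation (P : Problem n p m) (S : Trajectory n p m) (T : ℕ) : ℝ :=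
  ∑ t ∈ Finset.Ico 1 T, ∑ i, ‖nonnegPart (P.g i t (S.x i t))‖

lemma totalStep_nonneg : 0 ≤ totalStep S T :=
  Finset.sum_nonneg fun _ _ => Finset.sum_nonneg fun _ _ => norm_nonneg _

lemma disagreement_nonneg : 0 ≤ disagreement S T :=
  Finset.sum_nonneg fun _ _ => Finset.sum_nonneg fun _ _ => Finset.sum_nonneg fun _ _ =>
    norm_nonneg _

lemma sum_Ico_le_sum_Icc {u : ℕ → ℝ} (hu : ∀ t, 0 ≤ u t) (T : ℕ) :
    ∑ t ∈ Finset.Ico 1 T, u t ≤ ∑ t ∈ Finset.Icc 1 T, u t :=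
  Finset.sum_le_sum_of_subset_of_nonneg Finset.Ico_subset_Icc_self fun t _ _ => hu t

lemma IsGenerated.z_eq_mix (hS : IsGenerated P α β γ τ T S) (i : Fin n) {t : ℕ} (h1 : 1 ≤ t)
    (h2 : t < T) : S.z i (t + 1) = mix (P.W t) (fun j => S.xhat j t) i :=
  hS.step_z i t h1 h2

/-- The broadcast decisions are the averaging iteration; their perturbation `xhat - z` is a primal
step plus a triggering error of size at most `τ`. -/
lemma IsGenerated.sum_deviation_le (hD : P.RegularData F₁ F₂ R) (hN : P.RegularNetwork w B)
    (hw : 0 < w) (hR : 0 ≤ R) (hτ : ∀ t, 0 ≤ τ t) (hS : IsGenerated P α β γ τ T S) :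
    n * w ^ (n * B) * ∑ t ∈ Finset.Icc 1 T, deviation (fun i => S.xhat i t) ≤
      2 * (n * B : ℕ) * (n * R + (totalStep S T + n * ∑ t ∈ Finset.Icc 1 T, τ t)) := by
  refine (hN.sum_deviation_le hw hR (fun t i => S.xhat i t)
    fun t h1 h2 i => hD.bounded _ (hS.xhat_mem i h1 h2)).trans ?_
  gcongr
  refine le_trans ?_ (add_le_add le_rfl
    (mul_le_mul_of_nonneg_left (sum_shift_le hτ T) n.cast_nonneg))
  rw [totalStep, Finset.mul_sum, ← Finset.sum_add_distrib]
  refine Finset.sum_le_sum fun t ht => ?_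
  rw [Finset.mem_Ico] at ht
  have : (n : ℝ) * τ (t + 1) = ∑ i : Fin n, τ (t + 1) := by simp
  rw [this, ← Finset.sum_add_distrib]
  refine Finset.sum_le_sum fun i _ => ?_
  rw [← hS.z_eq_mix i ht.1 ht.2]
  have h1 := norm_sub_le_norm_sub_add_norm_sub (S.xhat i (t + 1)) (S.x i (t + 1)) (S.z i (t + 1))
  have h2 := hS.norm_xhat_sub_x_le hτ i (t := t + 1) (by omega) (by omega)
  linarith

lemma IsGenerated.disagreement_le (hτ : ∀ t, 0 ≤ τ t) (hS : IsGenerated P α β γ τ T S) :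
    disagreement S T ≤ 2 * n * (∑ t ∈ Finset.Icc 1 T, deviation (fun i => S.xhat i t) +
      n * ∑ t ∈ Finset.Icc 1 T, τ t) := by
  rw [Finset.mul_sum, ← Finset.sum_add_distrib, Finset.mul_sum, disagreement]
  refine Finset.sum_le_sum fun t ht => ?_
  rw [Finset.mem_Icc] at ht
  set b := mean fun i => S.xhat i t
  have h : ∀ i, ‖S.x i t - b‖ ≤ τ t + ‖S.xhat i t - b‖ := fun i => by
    refine (norm_sub_le_norm_sub_add_norm_sub _ (S.xhat i t) _).trans (add_le_add ?_ le_rfl)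
    rw [norm_sub_rev]
    exact hS.norm_xhat_sub_x_le hτ i ht.1 ht.2
  calc ∑ i, ∑ j, ‖S.x i t - S.x j t‖
      ≤ ∑ i, ∑ j, ((τ t + ‖S.xhat i t - b‖) + (τ t + ‖S.xhat j t - b‖)) := by
        refine Finset.sum_le_sum fun i _ => Finset.sum_le_sum fun j _ => ?_
        refine (norm_sub_le_norm_sub_add_norm_sub _ b _).trans (add_le_add (h i) ?_)
        rw [norm_sub_rev]
        exact h j
    _ = _ := by
        simp only [Finset.sum_add_distrib, Finset.sum_const, Finset.card_univ, Fintype.card_fin,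
          nsmul_eq_mul, deviation, ← Finset.mul_sum]
        ring

/-- The new decision is joined to the old one through `z`, the mean and `xhat`; the mean serves both
rounds because mixing preserves it. -/
lemma IsGenerated.totalMovement_le (hN : P.RegularNetwork w B) (hτ : ∀ t, 0 ≤ τ t)
    (hS : IsGenerated P α β γ τ T S) :
    totalMovement S T ≤ totalStep S T +
      (2 * ∑ t ∈ Finset.Icc 1 T, deviation (fun i => S.xhat i t) +
        n * ∑ t ∈ Finset.Icc 1 T, τ t) := by
  refine le_trans ?_ (add_le_add le_rfl (add_le_add (mul_le_mul_of_nonneg_left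
    (sum_Ico_le_sum_Icc (fun t => deviation_nonneg _) T) zero_le_two)
    (mul_le_mul_of_nonneg_left (sum_Ico_le_sum_Icc hτ T) n.cast_nonneg)))
  rw [Finset.mul_sum, Finset.mul_sum, totalMovement, totalStep, ← Finset.sum_add_distrib,
    ← Finset.sum_add_distrib]
  refine Finset.sum_le_sum fun t ht => ?_
  rw [Finset.mem_Ico] at ht
  set v := fun i => S.xhat i t
  have h1 := deviation_mix_le_self (hN.W_mem t ht.1) v
  calc ∑ i, ‖S.x i (t + 1) - S.x i t‖
      ≤ ∑ i, (‖S.x i (t + 1) - S.z i (t + 1)‖ +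
          (‖mix (P.W t) v i - mean (mix (P.W t) v)‖ + ‖v i - mean v‖ + τ t)) := by
        refine Finset.sum_le_sum fun i _ => ?_
        have h2 := hS.norm_xhat_sub_x_le hτ i ht.1 ht.2.le
        have h3 := hS.z_eq_mix i ht.1 ht.2
        rw [← h3, mean_mix (hN.W_mem t ht.1)]
        have h4 := norm_sub_le_norm_sub_add_norm_sub (S.x i (t + 1)) (S.z i (t + 1)) (S.x i t)
        have h5 := norm_sub_le_norm_sub_add_norm_sub (S.z i (t + 1)) (mean v) (S.x i t)
        have h6 := norm_sub_le_norm_sub_add_norm_sub (mean v) (v i) (S.x i t)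
        rw [norm_sub_rev (mean v) (v i)] at h6
        linarith
    _ = ∑ i, ‖S.x i (t + 1) - S.z i (t + 1)‖ +
          (deviation (mix (P.W t) v) + deviation v + n * τ t) := by
        simp [Finset.sum_add_distrib, deviation]
    _ ≤ _ := by linarith

/-- Weighted AM-GM, term by term. The parameter `s` stays free because regret and violation need
different choices. -/
lemma totalStep_le_stepEnergy (hα : ∀ t, 1 ≤ t → 0 < α t) {s : ℝ} (hs : 0 < s) :
    totalStep S T ≤ stepEnergy α S T / s + s * (n * ∑ t ∈ Finset.Ico 1 T, α (t + 1)) := by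
  rw [totalStep, stepEnergy, Finset.sum_div, Finset.mul_sum, Finset.mul_sum,
    ← Finset.sum_add_distrib]
  refine Finset.sum_le_sum fun t _ => ?_
  have : s * ((n : ℝ) * α (t + 1)) = ∑ i : Fin n, s * α (t + 1) := by simp; ring
  rw [this, Finset.sum_div, ← Finset.sum_add_distrib]
  refine Finset.sum_le_sum fun i _ => ?_
  have ha := hα (t + 1) (by omega)
  set a := ‖S.x i (t + 1) - S.z i (t + 1)‖
  have h1 : 0 ≤ (a - s * α (t + 1)) ^ 2 + a * (s * α (t + 1)) := by positivity
  rw [div_div, ← sub_nonneg]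
  have h2 : a ^ 2 / (α (t + 1) * s) + s * α (t + 1) - a =
      ((a - s * α (t + 1)) ^ 2 + a * (s * α (t + 1))) / (α (t + 1) * s) := by
    field_simp; ring
  rw [h2]; positivity

end Trajectories

end EventTriggered

namespace EventTriggered

/-! ### Summation over rounds and passage to network regret and violation -/

section Summation

variable {n p : ℕ} {m : Fin n → ℕ} {P : Problem n p m} {F₁ F₂ R w κ c : ℝ} {B T : ℕ}
  {α β γ τ : ℕ → ℝ} {S : Trajectory n p m}

lemma le_sum_of_le_sub {a u : ℕ → ℝ} (hT : 1 ≤ T)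
    (h : ∀ t, 1 ≤ t → t < T → u (t + 1) - u t ≤ a t) :
    u T - u 1 ≤ ∑ t ∈ Finset.Ico 1 T, a t := by
  induction T, hT using Nat.le_induction with
  | base => simp
  | succ T hT ih =>
    rw [Finset.sum_Ico_succ_top hT]
    linarith [h T hT (by omega), ih fun t h1 h2 => h t h1 (by omega)]

/-- The dual terms telescope. -/
lemma IsGenerated.neg_le_sum_dual (hκ : 0 < κ) (hT : 1 ≤ T)
    (hS : IsGenerated P α (stepBeta κ) (regGamma κ) τ T S) (i : Fin n) (μ : Vec (m i)) :
    -(‖μ‖ ^ 2 / 2) ≤ ∑ t ∈ Finset.Ico 1 T,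
      (‖S.q i (t + 1) - μ‖ ^ 2 - (1 - stepBeta κ (t + 1) * regGamma κ (t + 1)) *
        ‖S.q i t - μ‖ ^ 2) / (2 * regGamma κ (t + 1)) := by
  have h := le_sum_of_le_sub (T := T) (u := fun t => ‖S.q i t - μ‖ ^ 2 / (2 * regGamma κ t))
    (a := fun t => (‖S.q i (t + 1) - μ‖ ^ 2 - (1 - stepBeta κ (t + 1) * regGamma κ (t + 1)) *
        ‖S.q i t - μ‖ ^ 2) / (2 * regGamma κ (t + 1))) hT fun t h1 h2 => ?_
  · refine le_trans ?_ h
    have h1 : 0 ≤ ‖S.q i T - μ‖ ^ 2 / (2 * regGamma κ T) := by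
      have := regGamma_pos (κ := κ) hT
      positivity
    -- With `q = 0` at time one, the initial term of the telescope is exactly `‖μ‖ ^ 2 / 2`.
    have h2 : regGamma κ 1 = 1 := by simp [regGamma]
    simp only [hS.init_q i, zero_sub, norm_neg, h2]
    linarith
  · have h3 := mul_le_mul_of_nonneg_right (one_sub_div_regGamma_succ_le hκ h1)
      (by positivity : 0 ≤ ‖S.q i t - μ‖ ^ 2 / 2)
    have h4 : (1 - stepBeta κ (t + 1) * regGamma κ (t + 1)) / regGamma κ (t + 1) *
        (‖S.q i t - μ‖ ^ 2 / 2) = (1 - stepBeta κ (t + 1) * regGamma κ (t + 1)) *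
        ‖S.q i t - μ‖ ^ 2 / (2 * regGamma κ (t + 1)) := by
      rw [div_mul_div_comm, mul_comm (regGamma κ (t + 1)) 2]
    have h5 : 1 / regGamma κ t * (‖S.q i t - μ‖ ^ 2 / 2) =
        ‖S.q i t - μ‖ ^ 2 / (2 * regGamma κ t) := by
      rw [div_mul_div_comm, one_mul, mul_comm (regGamma κ t) 2]
    rw [h4, h5] at h3
    simp only [sub_div] at h3 ⊢
    linarith

/-- The primal terms telescope up to the event-triggering errors and the path-length. -/
lemma IsGenerated.sum_primal_le (hD : P.RegularData F₁ F₂ R) (hN : P.RegularNetwork w B)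
    (hR : 0 ≤ R) (hc : 1 < c) (hT : 1 ≤ T)
    (hS : IsGenerated P (stepAlpha (geomThreshold c)) β γ (geomThreshold c) T S) {y : ℕ → Vec p}
    (hy : y ∈ P.feasibleSequences T) :
    ∑ t ∈ Finset.Ico 1 T, ∑ i, (‖S.z i (t + 1) - y t‖ ^ 2 - ‖S.x i (t + 1) - y t‖ ^ 2) /
        (2 * stepAlpha (geomThreshold c) (t + 1)) ≤
      √c * (T : ℝ) ^ (1 / 2 : ℝ) * (2 * n * R * (R + 1 / (c - 1) + pathLength T y)) := by
  have hτ : ∀ t, 0 ≤ geomThreshold c t := fun t => (geomThreshold_pos hc t).le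
  have hyX : ∀ t, 1 ≤ t → t ≤ T → y t ∈ P.X := fun t h1 h2 => (hy t (Finset.mem_Icc.2 ⟨h1, h2⟩)).1
  set a : ℕ → ℝ := fun t => 1 / (2 * stepAlpha (geomThreshold c) t) with ha
  have ha0 : ∀ t, 1 ≤ t → 0 ≤ a t := fun t ht => by
    have := stepAlpha_pos hc ht
    positivity
  have ha1 : ∀ t, 1 ≤ t → a t ≤ a (t + 1) := fun t ht => by
    have h1 := stepAlpha_pos hc (t := t + 1) (by omega)
    have h2 := stepAlpha_succ_le hc ht
    simp only [ha]
    gcongr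
  -- The triggering errors and comparator drifts are all charged at the largest weight `a T`.
  have ha2 : ∀ t s, 1 ≤ t → t ≤ s → a t ≤ a s := fun t s h1 h2 => by
    induction s, h2 using Nat.le_induction with
    | base => exact le_rfl
    | succ s h2 ih => exact ih.trans (ha1 s (h1.trans h2))
  set d : ℕ → ℝ := fun t => ∑ i, ‖S.x i t - y t‖ ^ 2 with hd
  have hterm : ∀ t ∈ Finset.Ico 1 T,
      ∑ i, (‖S.z i (t + 1) - y t‖ ^ 2 - ‖S.x i (t + 1) - y t‖ ^ 2) /
        (2 * stepAlpha (geomThreshold c) (t + 1)) ≤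
      a (t + 1) * (d t - d (t + 1)) +
        a T * (4 * n * R * geomThreshold c t + 4 * n * R * ‖y (t + 1) - y t‖) := by
    intro t ht
    rw [Finset.mem_Ico] at ht
    have hyt := hyX t ht.1 ht.2.le
    have hyt' := hyX (t + 1) (by omega) (by omega)
    have h1 : ∑ i, ‖S.z i (t + 1) - y t‖ ^ 2 ≤ d t + 4 * n * R * geomThreshold c t := by
      calc ∑ i, ‖S.z i (t + 1) - y t‖ ^ 2
          = ∑ i, ‖mix (P.W t) (fun j => S.xhat j t) i - y t‖ ^ 2 := by
            simp_rw [hS.z_eq_mix _ ht.1 ht.2]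
        _ ≤ ∑ i, ‖S.xhat i t - y t‖ ^ 2 := sum_norm_mix_sub_sq_le (hN.W_mem t ht.1) _ _
        _ ≤ ∑ i, (‖S.x i t - y t‖ ^ 2 + 4 * R * geomThreshold c t) := by
            refine Finset.sum_le_sum fun i _ => ?_
            refine (hD.norm_sub_sq_le (hS.xhat_mem i ht.1 ht.2.le) (hS.x_mem i ht.1 ht.2.le)
              hyt hyt).trans ?_
            rw [sub_self, norm_zero, add_zero]
            gcongr
            exact hS.norm_xhat_sub_x_le hτ i ht.1 ht.2.le
        _ = _ := by simp [Finset.sum_add_distrib, hd]; ring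
    have h2 : d (t + 1) ≤ ∑ i, ‖S.x i (t + 1) - y t‖ ^ 2 + 4 * n * R * ‖y (t + 1) - y t‖ := by
      calc d (t + 1) ≤ ∑ i, (‖S.x i (t + 1) - y t‖ ^ 2 + 4 * R * ‖y (t + 1) - y t‖) := by
            refine Finset.sum_le_sum fun i _ => ?_
            have hx := hS.x_mem i (t := t + 1) (by omega) (by omega)
            have := hD.norm_sub_sq_le hx hx hyt' hyt
            rwa [sub_self, norm_zero, zero_add] at this
        _ = _ := by simp [Finset.sum_add_distrib]; ring
    have h3 : 0 ≤ 4 * n * R * geomThreshold c t + 4 * n * R * ‖y (t + 1) - y t‖ := by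
      have := hτ t
      positivity
    have h4 := mul_le_mul_of_nonneg_right (ha2 (t + 1) T (by omega) (by omega)) h3
    rw [← Finset.sum_div, Finset.sum_sub_distrib, div_eq_mul_one_div, mul_comm]
    have h5 := mul_le_mul_of_nonneg_left (sub_le_sub h1 (sub_le_iff_le_add.2 h2))
      (ha0 (t + 1) (by omega))
    simp only [ha] at h4 h5 ⊢
    linarith
  refine (Finset.sum_le_sum hterm).trans ?_
  rw [Finset.sum_add_distrib, ← Finset.mul_sum, Finset.sum_add_distrib, ← Finset.mul_sum,
    ← Finset.mul_sum]
  have h1 := sum_weighted_telescope_le (a := a) (d := d) (M := 4 * n * R ^ 2)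
    (fun t => Finset.sum_nonneg fun _ _ => by positivity) hT (fun t h1 h2 => ?_) (ha0 1 le_rfl) ha1
  · have h2 := (sum_Ico_le_sum_Icc hτ T).trans (sum_geomThreshold_le hc T)
    have h3 : 0 ≤ pathLength T y := Finset.sum_nonneg fun _ _ => norm_nonneg _
    have h4 : a T ≤ √c * (T : ℝ) ^ (1 / 2 : ℝ) / 2 := by
      have := one_div_stepAlpha_le hc hT
      simp only [ha]
      rw [one_div, mul_inv, ← one_div, ← one_div]
      linarith
    have h5 : 0 ≤ 1 / (c - 1) := by
      have : 0 < c - 1 := by linarith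
      positivity
    calc _ ≤ a T * (4 * n * R ^ 2) +
          a T * (4 * n * R * (1 / (c - 1)) + 4 * n * R * pathLength T y) := by
          have := ha0 T hT
          refine add_le_add h1 (mul_le_mul_of_nonneg_left (add_le_add ?_ le_rfl) this)
          gcongr
      _ = a T * (4 * n * R * (R + 1 / (c - 1) + pathLength T y)) := by ring
      _ ≤ √c * (T : ℝ) ^ (1 / 2 : ℝ) / 2 * (4 * n * R * (R + 1 / (c - 1) + pathLength T y)) := by
          gcongr
      _ = _ := by ring
  · calc d t ≤ ∑ i : Fin n, (2 * R) ^ 2 := Finset.sum_le_sum fun i _ =>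
          pow_le_pow_left₀ (norm_nonneg _) (hD.norm_sub_le (hS.x_mem i h1 h2) (hyX t h1 h2)) 2
      _ = _ := by simp; ring

/-- The basic inequality, summed over agents and rounds. -/
lemma IsGenerated.localRegret_add_le (hD : P.RegularData F₁ F₂ R) (hP : P.PosPartSubgradients)
    (hN : P.RegularNetwork w B) (hF₁ : 0 ≤ F₁) (hF₂ : 0 ≤ F₂) (hR : 0 ≤ R) (hκ₀ : 0 < κ)
    (hκ₁ : κ < 1) (hc : 1 < c)
    (hT : 1 ≤ T) (hS : IsGenerated P (stepAlpha (geomThreshold c)) (stepBeta κ) (regGamma κ)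
      (geomThreshold c) T S) {y : ℕ → Vec p} (hy : y ∈ P.feasibleSequences T) {r : ℝ}
    (hr : 0 ≤ r) :
    localRegret P S T y + r * localViolation P S T +
        stepEnergy (stepAlpha (geomThreshold c)) S T / 2 ≤
      n * (2 * F₁ + 2 * R * F₂) ^ 2 / 2 * ((T : ℝ) ^ κ / κ) +
        (∑ i, m i : ℕ) * r ^ 2 / 2 * (1 + (T : ℝ) ^ (1 - κ) / (1 - κ)) +
        F₂ * (1 + (∑ i, m i : ℕ) * r) * totalMovement S T +
        √c * (T : ℝ) ^ (1 / 2 : ℝ) * (2 * n * R * (R + 1 / (c - 1) + pathLength T y)) := by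
  set M : ℝ := ((∑ i, m i : ℕ) : ℝ) with hM
  set C : ℝ := (2 * F₁ + 2 * R * F₂) ^ 2 with hC
  have hMi : ∀ i, (m i : ℝ) ≤ M := fun i => by
    rw [hM]
    exact_mod_cast Finset.single_le_sum (f := m) (fun _ _ => Nat.zero_le _) (Finset.mem_univ i)
  have hstep : ∀ t ∈ Finset.Ico 1 T, ∀ i : Fin n,
      (P.f i t (S.x i t) - P.f i t (y t)) + r * ‖nonnegPart (P.g i t (S.x i t))‖ +
        ‖S.x i (t + 1) - S.z i (t + 1)‖ ^ 2 / stepAlpha (geomThreshold c) (t + 1) / 2 +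
        (‖S.q i (t + 1) - constVec _ r‖ ^ 2 -
          (1 - stepBeta κ (t + 1) * regGamma κ (t + 1)) * ‖S.q i t - constVec _ r‖ ^ 2) /
            (2 * regGamma κ (t + 1)) ≤
      regGamma κ (t + 1) * (C / 2) + stepBeta κ (t + 1) * (m i * r ^ 2 / 2) +
        F₂ * (1 + M * r) * ‖S.x i (t + 1) - S.x i t‖ +
        (‖S.z i (t + 1) - y t‖ ^ 2 - ‖S.x i (t + 1) - y t‖ ^ 2) /
          (2 * stepAlpha (geomThreshold c) (t + 1)) := by
    intro t ht i
    rw [Finset.mem_Ico] at ht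
    obtain ⟨h1, h2⟩ := ht
    have hx := hS.x_mem i h1 h2.le
    have hx' := hS.x_mem i (t := t + 1) (by omega) (by omega)
    have hyt := hy t (Finset.mem_Icc.2 ⟨h1, h2.le⟩)
    have hproj := hS.step_x i t h1 h2
    rw [hS.step_ω i t h1 h2] at hproj
    -- The update uses the later index of `β` with the earlier `q`; monotonicity of `β` bridges the
    -- shift.
    have hqb : stepBeta κ (t + 1) * ‖S.q i t‖ ≤ F₁ :=
      (mul_le_mul_of_nonneg_right (stepBeta_succ_le hκ₀ h1) (norm_nonneg _)).trans
        (hS.stepBeta_mul_norm_q_le hD hP hF₁ hκ₀ i h1 h2.le)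
    have key := primal_dual_step_le (r := r) hD.convex hyt.1 (hD.subf_spec i t h1 _ hx)
      (hD.subf_bound i t h1 _ hx) (hP.isSubgradient i t h1 _ hx) (hD.norm_subgPos_le hP h1 hx)
      (hD.g_bound i t h1 _ hx) (fun l => hyt.2 ⟨i, l⟩) (hD.norm_sub_le hx' hx)
      (hS.q_nonneg i h1 h2.le) hqb (stepAlpha_pos hc (by omega)) (stepBeta_pos (by omega)).le
      (regGamma_pos (by omega)) hr hproj (hS.step_q i t h1 h2)
    have h3 : F₂ * (1 + m i * r) * ‖S.x i (t + 1) - S.x i t‖ ≤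
        F₂ * (1 + M * r) * ‖S.x i (t + 1) - S.x i t‖ := by
      gcongr
      exact hMi i
    rw [div_div, mul_comm (stepAlpha (geomThreshold c) (t + 1)) 2]
    linarith
  have hsum := Finset.sum_le_sum fun t ht => Finset.sum_le_sum fun i (_ : i ∈ Finset.univ) =>
    hstep t ht i
  simp only [Finset.sum_add_distrib] at hsum
  have hdual : -(M * r ^ 2 / 2) ≤ ∑ t ∈ Finset.Ico 1 T, ∑ i,
      (‖S.q i (t + 1) - constVec _ r‖ ^ 2 -
          (1 - stepBeta κ (t + 1) * regGamma κ (t + 1)) * ‖S.q i t - constVec _ r‖ ^ 2) /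
            (2 * regGamma κ (t + 1)) := by
    rw [Finset.sum_comm]
    refine le_trans (le_of_eq ?_) (Finset.sum_le_sum fun i _ =>
      hS.neg_le_sum_dual hκ₀ hT i (constVec _ r))
    simp only [norm_constVec_sq, Fintype.card_fin]
    rw [Finset.sum_neg_distrib, ← Finset.sum_div, ← Finset.sum_mul, hM]
    push_cast
    ring
  have hgamma : ∑ t ∈ Finset.Ico 1 T, ∑ i : Fin n, regGamma κ (t + 1) * (C / 2) ≤
      n * C / 2 * ((T : ℝ) ^ κ / κ) := by
    have := mul_le_mul_of_nonneg_left (sum_regGamma_le hκ₀ hκ₁ T)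
      (by positivity : 0 ≤ n * C / 2)
    refine le_trans (le_of_eq ?_) this
    rw [Finset.mul_sum]
    refine Finset.sum_congr rfl fun t _ => ?_
    simp; ring
  have hbeta : ∑ t ∈ Finset.Ico 1 T, ∑ i : Fin n, stepBeta κ (t + 1) * (m i * r ^ 2 / 2) ≤
      M * r ^ 2 / 2 * ((T : ℝ) ^ (1 - κ) / (1 - κ)) := by
    have := mul_le_mul_of_nonneg_left (sum_stepBeta_le hκ₀ hκ₁ T)
      (by positivity : 0 ≤ M * r ^ 2 / 2)
    refine le_trans (le_of_eq ?_) this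
    rw [Finset.mul_sum]
    refine Finset.sum_congr rfl fun t _ => ?_
    rw [← Finset.mul_sum, ← Finset.sum_div, ← Finset.sum_mul, hM]
    push_cast; ring
  have hprim := hS.sum_primal_le hD hN hR hc hT hy
  have h1 : ∑ t ∈ Finset.Ico 1 T, ∑ i, r * ‖nonnegPart (P.g i t (S.x i t))‖ =
      r * localViolation P S T := by
    simp_rw [localViolation, Finset.mul_sum]
  have h2 : ∑ t ∈ Finset.Ico 1 T, ∑ i, F₂ * (1 + M * r) * ‖S.x i (t + 1) - S.x i t‖ =
      F₂ * (1 + M * r) * totalMovement S T := by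
    simp_rw [totalMovement, Finset.mul_sum]
  have h3 : ∑ t ∈ Finset.Ico 1 T, ∑ i,
      ‖S.x i (t + 1) - S.z i (t + 1)‖ ^ 2 / stepAlpha (geomThreshold c) (t + 1) / 2 =
      stepEnergy (stepAlpha (geomThreshold c)) S T / 2 := by
    simp_rw [stepEnergy, Finset.sum_div]
  rw [h1, h2, h3] at hsum
  rw [localRegret]
  linarith

lemma norm_nonnegPart_globalConstraint_le (P : Problem n p m) (t : ℕ) (x : Vec p) :
    ‖nonnegPart (P.globalConstraint t x)‖ ≤ ∑ j, ‖nonnegPart (P.g j t x)‖ := by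
  have h : ‖nonnegPart (P.globalConstraint t x)‖ ^ 2 = ∑ j, ‖nonnegPart (P.g j t x)‖ ^ 2 := by
    simp_rw [EuclideanSpace.norm_sq_eq, Fintype.sum_sigma]
    rfl
  refine (sq_le_sq₀ (norm_nonneg _) (Finset.sum_nonneg fun _ _ => norm_nonneg _)).1 ?_
  rw [h]
  exact Finset.sum_sq_le_sq_sum_of_nonneg fun _ _ => norm_nonneg _

/-- The constraint of agent `j` at another agent's decision is compared with its value at `j`'s own
decision, at the cost of the disagreement. Round `T` has no update after it and is bounded
separately by `n * F₁`. -/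
lemma IsGenerated.netCCV_le (hD : P.RegularData F₁ F₂ R) (hP : P.PosPartSubgradients)
    (hn : 0 < n) (hT : 1 ≤ T) (hS : IsGenerated P α β γ τ T S) :
    netCCV P T S.x ≤ localViolation P S T + n * F₁ + F₂ * disagreement S T := by
  have hn' : (0 : ℝ) < n := by exact_mod_cast hn
  have hround : ∀ t ∈ Finset.Icc 1 T, ∑ i, ‖nonnegPart (P.globalConstraint t (S.x i t))‖ ≤
      n * ∑ j, ‖nonnegPart (P.g j t (S.x j t))‖ + F₂ * ∑ i, ∑ j, ‖S.x i t - S.x j t‖ := by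
    intro t ht
    rw [Finset.mem_Icc] at ht
    calc ∑ i, ‖nonnegPart (P.globalConstraint t (S.x i t))‖
        ≤ ∑ i, ∑ j, (‖nonnegPart (P.g j t (S.x j t))‖ + F₂ * ‖S.x i t - S.x j t‖) := by
          refine Finset.sum_le_sum fun i _ =>
            (norm_nonnegPart_globalConstraint_le P t _).trans (Finset.sum_le_sum fun j _ => ?_)
          have hx := hS.x_mem i ht.1 ht.2
          exact norm_nonnegPart_le_add (hP.isSubgradient j t ht.1 _ hx)
            (hD.norm_subgPos_le hP ht.1 hx) (hS.x_mem j ht.1 ht.2)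
      _ = _ := by simp [Finset.sum_add_distrib, ← Finset.mul_sum]
  have hlast : ∑ j, ‖nonnegPart (P.g j T (S.x j T))‖ ≤ n * F₁ := by
    refine (Finset.sum_le_sum fun j _ => (norm_nonnegPart_le _).trans
      (hD.g_bound j T hT _ (hS.x_mem j hT le_rfl))).trans_eq (by simp)
  have hsplit : ∑ t ∈ Finset.Icc 1 T, ∑ j, ‖nonnegPart (P.g j t (S.x j t))‖ =
      localViolation P S T + ∑ j, ‖nonnegPart (P.g j T (S.x j T))‖ := by
    rw [localViolation, ← Finset.sum_Ico_succ_top hT]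
    rfl
  have hF₂ : 0 ≤ F₂ * disagreement S T := by
    have hx := hS.x_mem ⟨0, hn⟩ hT le_rfl
    exact mul_nonneg ((norm_nonneg _).trans (hD.norm_subgPos_le hP (i := ⟨0, hn⟩) hT hx))
      disagreement_nonneg
  have h1 := Finset.sum_le_sum hround
  rw [Finset.sum_add_distrib, ← Finset.mul_sum, ← Finset.mul_sum, hsplit, Finset.sum_comm] at h1
  have hn1 : 1 / (n : ℝ) ≤ 1 := by
    rw [div_le_one hn']; exact_mod_cast hn
  calc netCCV P T S.x ≤ (1 / (n : ℝ)) * (n * (localViolation P S T +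
        ∑ j, ‖nonnegPart (P.g j T (S.x j T))‖) + F₂ * disagreement S T) := by
        unfold netCCV
        gcongr
        exact h1
    _ = localViolation P S T + ∑ j, ‖nonnegPart (P.g j T (S.x j T))‖ +
          1 / (n : ℝ) * (F₂ * disagreement S T) := by field_simp
    _ ≤ _ := by
        have := mul_le_of_le_one_left hF₂ hn1
        linarith

lemma IsGenerated.netReg_le (hD : P.RegularData F₁ F₂ R)
    (hn : 0 < n) (hT : 1 ≤ T) (hS : IsGenerated P α β γ τ T S) {y : ℕ → Vec p}
    (hy : y ∈ P.feasibleSequences T) :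
    netReg P T S.x y ≤
      1 / (n : ℝ) * (localRegret P S T y + n * F₁ + F₂ * disagreement S T) := by
  have hn' : (0 : ℝ) < n := by exact_mod_cast hn
  have hround : ∀ t ∈ Finset.Icc 1 T,
      ∑ i, (P.globalLoss t (S.x i t) - P.globalLoss t (y t)) ≤
      ∑ j, (P.f j t (S.x j t) - P.f j t (y t)) +
        (1 / (n : ℝ)) * (F₂ * ∑ i, ∑ j, ‖S.x i t - S.x j t‖) := by
    intro t ht
    rw [Finset.mem_Icc] at ht
    calc ∑ i, (P.globalLoss t (S.x i t) - P.globalLoss t (y t))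
        = (1 / (n : ℝ)) * ∑ i, ∑ j, (P.f j t (S.x i t) - P.f j t (y t)) := by
          simp_rw [Problem.globalLoss, ← mul_sub, ← Finset.sum_sub_distrib, ← Finset.mul_sum]
      _ ≤ (1 / (n : ℝ)) * ∑ i, ∑ j, ((P.f j t (S.x j t) - P.f j t (y t)) +
            F₂ * ‖S.x i t - S.x j t‖) := by
          gcongr with i _ j _
          have := hD.f_le_add (i := j) ht.1 (hS.x_mem i ht.1 ht.2) (hS.x_mem j ht.1 ht.2)
          linarith
      _ = _ := by
          simp only [Finset.sum_add_distrib, ← Finset.mul_sum, Finset.sum_const,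
            Finset.card_univ, Fintype.card_fin, nsmul_eq_mul]
          field_simp
  have hlast : ∑ j, (P.f j T (S.x j T) - P.f j T (y T)) ≤ n * F₁ := by
    refine (Finset.sum_le_sum fun j _ => le_of_abs_le (hD.f_bound j T hT _
      (hS.x_mem j hT le_rfl) _ (hy T (Finset.mem_Icc.2 ⟨hT, le_rfl⟩)).1)).trans_eq (by simp)
  have hsplit : ∑ t ∈ Finset.Icc 1 T, ∑ j, (P.f j t (S.x j t) - P.f j t (y t)) =
      localRegret P S T y + ∑ j, (P.f j T (S.x j T) - P.f j T (y T)) := by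
    rw [localRegret, ← Finset.sum_Ico_succ_top hT]
    rfl
  have hF₂ : 0 ≤ F₂ * disagreement S T := by
    have hx := hS.x_mem ⟨0, hn⟩ hT le_rfl
    exact mul_nonneg ((norm_nonneg _).trans (hD.subf_bound ⟨0, hn⟩ T hT _ hx))
      disagreement_nonneg
  have h1 := Finset.sum_le_sum hround
  rw [Finset.sum_add_distrib, hsplit, ← Finset.mul_sum, ← Finset.mul_sum] at h1
  have hn1 : 1 / (n : ℝ) ≤ 1 := by
    rw [div_le_one hn']; exact_mod_cast hn
  have hreg : netReg P T S.x y = (1 / (n : ℝ)) *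
      ∑ t ∈ Finset.Icc 1 T, ∑ i, (P.globalLoss t (S.x i t) - P.globalLoss t (y t)) := by
    rw [netReg]
    simp only [Finset.sum_sub_distrib, Finset.sum_const, Finset.card_univ, Fintype.card_fin,
      nsmul_eq_mul, ← Finset.mul_sum]
    rw [Finset.sum_comm]
    field_simp
  rw [hreg]
  refine mul_le_mul_of_nonneg_left ?_ (by positivity)
  have h2 := mul_le_of_le_one_left hF₂ hn1
  have h3 : ∑ t ∈ Finset.Icc 1 T, ∑ i, ∑ j, ‖S.x i t - S.x j t‖ = disagreement S T := rfl
  rw [h3] at h1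
  linarith

/-- A crude linear bound suffices: it lets the basic inequality bound the step energy and the
violation even when the regret is very negative. -/
lemma IsGenerated.neg_le_localRegret (hD : P.RegularData F₁ F₂ R) (hF₁ : 0 ≤ F₁)
    (hS : IsGenerated P α β γ τ T S) {y : ℕ → Vec p} (hy : y ∈ P.feasibleSequences T) :
    -(n * F₁ * T) ≤ localRegret P S T y := by
  have h : ∑ t ∈ Finset.Ico 1 T, -(n * F₁) ≤ localRegret P S T y := by
    refine Finset.sum_le_sum fun t ht => ?_
    rw [Finset.mem_Ico] at ht
    refine le_trans (le_of_eq (by simp)) (Finset.sum_le_sum (f := fun _ : Fin n => -F₁)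
      fun i _ => neg_le_of_abs_le (hD.f_bound i t ht.1 _ (hS.x_mem i ht.1 ht.2.le) _
        (hy t (Finset.mem_Icc.2 ⟨ht.1, ht.2.le⟩)).1))
  refine le_trans ?_ h
  rw [Finset.sum_const, Nat.card_Ico, nsmul_eq_mul]
  have h1 : ((T - 1 : ℕ) : ℝ) ≤ T := by exact_mod_cast Nat.sub_le _ _
  nlinarith [mul_nonneg n.cast_nonneg hF₁ (α := ℝ)]

end Summation

end EventTriggered

namespace EventTriggered

/-! ### Uniform constants for all the estimates -/

section Rates

/-- The thresholds have total at most `1 / (c - 1)`, so event triggering costs only a constant and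
the primal steps are the sole growing source of disagreement and movement. -/
lemma exists_consensus_bound {n : ℕ} (hn : 0 < n) {w R c : ℝ} (B : ℕ) (hw : 0 < w) (hR : 0 < R)
    (hc : 1 < c) :
    ∃ K : ℝ, 0 < K ∧ ∀ {p : ℕ} {m : Fin n → ℕ} {P : Problem n p m} {F₁ F₂ : ℝ} {T : ℕ}
      {α β γ : ℕ → ℝ} {S : Trajectory n p m}, P.RegularData F₁ F₂ R → P.RegularNetwork w B →
      IsGenerated P α β γ (geomThreshold c) T S →
      disagreement S T ≤ K * (1 + totalStep S T) ∧
        totalMovement S T ≤ K * (1 + totalStep S T) := by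
  have hn' : (0 : ℝ) < n := by exact_mod_cast hn
  have hc' : 0 < c - 1 := by linarith
  set θ := 1 / (c - 1) with hθ
  have hθ0 : 0 < θ := by positivity
  set ℓ := n * w ^ (n * B) with hℓ
  have hℓ0 : 0 < ℓ := by positivity
  set K₁ : ℝ := 2 * (n * B : ℕ) / ℓ * (n * R + n * θ + 1) with hK₁
  have hK₁0 : 0 ≤ K₁ := by positivity
  refine ⟨2 * n * (K₁ + n * θ) + (1 + 2 * K₁ + n * θ), by positivity, ?_⟩
  intro p m P F₁ F₂ T α β γ S hD hN hS
  have hτ : ∀ t, 0 ≤ geomThreshold c t := fun t => (geomThreshold_pos hc t).le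
  have hA : 0 ≤ totalStep S T := totalStep_nonneg
  have hτs : n * ∑ t ∈ Finset.Icc 1 T, geomThreshold c t ≤ n * θ :=
    mul_le_mul_of_nonneg_left (sum_geomThreshold_le hc T) hn'.le
  have hdev : ∑ t ∈ Finset.Icc 1 T, deviation (fun i => S.xhat i t) ≤
      K₁ * (1 + totalStep S T) := by
    have h := hS.sum_deviation_le hD hN hw hR.le hτ
    rw [← hℓ, mul_comm, ← le_div_iff₀ hℓ0] at h
    refine h.trans ?_
    rw [mul_div_right_comm, hK₁, mul_assoc]
    refine mul_le_mul_of_nonneg_left ?_ (by positivity)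
    have : 0 ≤ (n * R + n * θ) * totalStep S T := by positivity
    linarith
  have h1 := hS.disagreement_le hτ
  have h2 := hS.totalMovement_le hN hτ
  have h3 : n * θ ≤ n * θ * (1 + totalStep S T) := le_mul_of_one_le_right (by positivity)
    (by linarith)
  have h4 : 2 * n * (∑ t ∈ Finset.Icc 1 T, deviation (fun i => S.xhat i t) +
      n * ∑ t ∈ Finset.Icc 1 T, geomThreshold c t) ≤
      2 * n * (K₁ * (1 + totalStep S T) + n * θ * (1 + totalStep S T)) := by
    exact mul_le_mul_of_nonneg_left (add_le_add hdev (hτs.trans h3)) (by positivity)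
  have h5 : 0 ≤ 2 * n * (K₁ + n * θ) * (1 + totalStep S T) := by positivity
  have h6 : 0 ≤ (1 + 2 * K₁ + n * θ) * (1 + totalStep S T) := by positivity
  constructor
  · linarith
  · linarith

set_option maxHeartbeats 800000 in
/-- All estimates that enter the final rates, with one constant. -/
lemma exists_estimates {n : ℕ} (hn : 0 < n) (m : Fin n → ℕ) {F₁ F₂ R w κ c : ℝ} (B : ℕ)
    (hF₁ : 0 < F₁) (hF₂ : 0 < F₂) (hR : 0 < R) (hw : 0 < w) (hκ₀ : 0 < κ) (hκ₁ : κ < 1)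
    (hc : 1 < c) :
    ∃ K : ℝ, 0 < K ∧ ∀ {p : ℕ} {P : Problem n p m} {T : ℕ} {S : Trajectory n p m},
      P.RegularData F₁ F₂ R → P.PosPartSubgradients → P.RegularNetwork w B → 1 ≤ T →
      IsGenerated P (stepAlpha (geomThreshold c)) (stepBeta κ) (regGamma κ) (geomThreshold c) T S →
      (∀ y ∈ P.feasibleSequences T, ∀ r : ℝ, 0 ≤ r →
        localRegret P S T y + r * localViolation P S T +
          stepEnergy (stepAlpha (geomThreshold c)) S T / 2 ≤
        K * ((T : ℝ) ^ max κ (1 / 2) + (T : ℝ) ^ (1 / 2 : ℝ) * pathLength T y +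
          r ^ 2 * (T : ℝ) ^ (1 - κ) + (1 + r) * (1 + totalStep S T))) ∧
      (∀ s : ℝ, 0 < s → totalStep S T ≤
        stepEnergy (stepAlpha (geomThreshold c)) S T / s + s * (K * (T : ℝ) ^ (1 / 2 : ℝ))) ∧
      (∀ y ∈ P.feasibleSequences T, -(K * T) ≤ localRegret P S T y) ∧
      (∀ y ∈ P.feasibleSequences T, netReg P T S.x y ≤
        1 / (n : ℝ) * (localRegret P S T y + K * (1 + totalStep S T))) ∧
      netCCV P T S.x ≤ localViolation P S T + K * (1 + totalStep S T) := by
  have hn' : (0 : ℝ) < n := by exact_mod_cast hn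
  have hc' : 0 < c - 1 := by linarith
  have hκ' : 0 < 1 - κ := by linarith
  obtain ⟨K₀, hK₀, hcons⟩ := exists_consensus_bound hn B hw hR hc
  set θ := 1 / (c - 1) with hθ
  have hθ0 : 0 < θ := by positivity
  set M : ℝ := ((∑ i, m i : ℕ) : ℝ) with hM
  have hM0 : 0 ≤ M := Nat.cast_nonneg _
  set k₁ := n * (2 * F₁ + 2 * R * F₂) ^ 2 / 2 / κ with hk₁
  set k₂ := M / 2 * (1 + 1 / (1 - κ)) with hk₂
  set k₃ := F₂ * (1 + M) * K₀ with hk₃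
  set k₄ := √c * (2 * n * R * (R + θ + 1)) with hk₄
  set k₅ := n * (2 * √θ) with hk₅
  set k₆ := n * F₁ + F₂ * K₀ with hk₆
  have h1 : 0 ≤ k₁ := by positivity
  have h2 : 0 ≤ k₂ := by positivity
  have h3 : 0 ≤ k₃ := by positivity
  have h4 : 0 ≤ k₄ := by positivity
  have h5 : 0 ≤ k₅ := by positivity
  have h6 : 0 < k₆ := by positivity
  refine ⟨k₁ + k₂ + k₃ + k₄ + k₅ + k₆, by positivity, ?_⟩
  set K := k₁ + k₂ + k₃ + k₄ + k₅ + k₆ with hK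
  intro p P T S hD hP hN hT hS
  obtain ⟨hdis, hmov⟩ := hcons hD hN hS
  have hT1 : (1 : ℝ) ≤ T := by exact_mod_cast hT
  have hA : 0 ≤ totalStep S T := totalStep_nonneg
  have hF₁K : n * F₁ ≤ K := by
    have : 0 ≤ F₂ * K₀ := by positivity
    linarith
  have hlast : n * F₁ + F₂ * disagreement S T ≤ K * (1 + totalStep S T) := by
    have e1 : F₂ * disagreement S T ≤ F₂ * (K₀ * (1 + totalStep S T)) := by gcongr
    have e2 : n * F₁ ≤ n * F₁ * (1 + totalStep S T) :=
      le_mul_of_one_le_right (by positivity) (by linarith)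
    have e3 : k₆ * (1 + totalStep S T) ≤ K * (1 + totalStep S T) := by
      gcongr; linarith
    linarith
  refine ⟨fun y hy r hr => ?_, fun s hs => ?_, fun y hy => ?_, fun y hy => ?_, ?_⟩
  · refine (hS.localRegret_add_le hD hP hN hF₁.le hF₂.le hR.le hκ₀ hκ₁ hc hT hy hr).trans ?_
    rw [← hM, ← hθ]
    have hPL : 0 ≤ pathLength T y := Finset.sum_nonneg fun _ _ => norm_nonneg _
    have e1 : n * (2 * F₁ + 2 * R * F₂) ^ 2 / 2 * ((T : ℝ) ^ κ / κ) ≤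
        k₁ * (T : ℝ) ^ max κ (1 / 2) := by
      rw [hk₁, ← mul_div_assoc, mul_div_right_comm]
      gcongr
      exact le_max_left _ _
    have e2 : M * r ^ 2 / 2 * (1 + (T : ℝ) ^ (1 - κ) / (1 - κ)) ≤
        k₂ * (r ^ 2 * (T : ℝ) ^ (1 - κ)) := by
      have : 1 ≤ (T : ℝ) ^ (1 - κ) := Real.one_le_rpow hT1 hκ'.le
      calc M * r ^ 2 / 2 * (1 + (T : ℝ) ^ (1 - κ) / (1 - κ))
          ≤ M * r ^ 2 / 2 * ((T : ℝ) ^ (1 - κ) + (T : ℝ) ^ (1 - κ) / (1 - κ)) := by gcongr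
        _ = _ := by rw [hk₂]; ring
    have e3 : F₂ * (1 + M * r) * totalMovement S T ≤
        k₃ * ((1 + r) * (1 + totalStep S T)) := by
      have hMr : 1 + M * r ≤ (1 + M) * (1 + r) := by linarith
      calc F₂ * (1 + M * r) * totalMovement S T
          ≤ F₂ * (1 + M * r) * (K₀ * (1 + totalStep S T)) := by gcongr
        _ ≤ F₂ * ((1 + M) * (1 + r)) * (K₀ * (1 + totalStep S T)) := by gcongr
        _ = _ := by rw [hk₃]; ring
    have e4 : √c * (T : ℝ) ^ (1 / 2 : ℝ) * (2 * n * R * (R + θ + pathLength T y)) ≤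
        k₄ * ((T : ℝ) ^ max κ (1 / 2) + (T : ℝ) ^ (1 / 2 : ℝ) * pathLength T y) := by
      have hRθ : 0 ≤ (R + θ) * pathLength T y := by positivity
      calc √c * (T : ℝ) ^ (1 / 2 : ℝ) * (2 * n * R * (R + θ + pathLength T y))
          ≤ √c * (T : ℝ) ^ (1 / 2 : ℝ) *
              (2 * n * R * ((R + θ + 1) * (1 + pathLength T y))) := by
            gcongr
            linarith
        _ = k₄ * ((T : ℝ) ^ (1 / 2 : ℝ) + (T : ℝ) ^ (1 / 2 : ℝ) * pathLength T y) := by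
            rw [hk₄]; ring
        _ ≤ _ := by
            gcongr
            exact le_max_right _ _
    set X := (T : ℝ) ^ max κ (1 / 2) with hX
    set Y := (T : ℝ) ^ (1 / 2 : ℝ) * pathLength T y with hY
    set Z := r ^ 2 * (T : ℝ) ^ (1 - κ) with hZ
    set U := (1 + r) * (1 + totalStep S T) with hU
    have hX0 : 0 ≤ X := by positivity
    have hY0 : 0 ≤ Y := by positivity
    have hZ0 : 0 ≤ Z := by positivity
    have hU0 : 0 ≤ U := by positivity
    have d1 : k₂ * Z ≤ K * Z := by gcongr; linarith
    have d2 : k₃ * U ≤ K * U := by gcongr; linarith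
    have d3 : (k₁ + k₄) * X ≤ K * X := by gcongr; linarith
    have d4 : k₄ * Y ≤ K * Y := by gcongr; linarith
    linarith
  · refine (totalStep_le_stepEnergy (fun t ht => stepAlpha_pos hc ht) hs).trans ?_
    refine add_le_add le_rfl (mul_le_mul_of_nonneg_left ?_ hs.le)
    have e1 := mul_le_mul_of_nonneg_left (sum_stepAlpha_le hc T) hn'.le
    rw [← hθ, ← mul_assoc] at e1
    refine e1.trans ?_
    gcongr
    linarith
  · refine le_trans ?_ (hS.neg_le_localRegret hD hF₁.le hy)
    gcongr
  · refine (hS.netReg_le hD hn hT hy).trans ?_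
    exact mul_le_mul_of_nonneg_left (by linarith) (by positivity)
  · have := hS.netCCV_le hD hP hn hT
    linarith

end Rates

end EventTriggered

/-! ### Choice of the free parameters and the final rates -/

theorem corollary2 (n : ℕ) (hn : 0 < n) (m : Fin n → ℕ)
    (F₁ F₂ R w κ c : ℝ) (B : ℕ)
    (hF₁ : 0 < F₁) (hF₂ : 0 < F₂) (hR : 0 < R) (hw : 0 < w ∧ w < 1) (hB : 0 < B)
    (hκ : 0 < κ ∧ κ < 1) (hc : 1 < c) :
    ∃ C : ℝ, 0 < C ∧
      ∀ (p : ℕ) (P : EventTriggered.Problem n p m),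
        P.RegularData F₁ F₂ R → P.PosPartSubgradients → P.RegularNetwork w B →
        ∀ T : ℕ, 1 ≤ T → (P.feasibleStatic T).Nonempty →
        ∀ S : EventTriggered.Trajectory n p m,
          EventTriggered.IsGenerated P
            (EventTriggered.stepAlpha (EventTriggered.geomThreshold c))
            (EventTriggered.stepBeta κ) (EventTriggered.regGamma κ)
            (EventTriggered.geomThreshold c) T S →
          (∀ y ∈ P.feasibleSequences T,
            EventTriggered.netReg P T S.x y ≤
              C * ((T : ℝ) ^ max κ (1 / 2) +
                (T : ℝ) ^ (1 / 2 : ℝ) * EventTriggered.pathLength T y)) ∧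
          EventTriggered.netCCV P T S.x ≤ C * (T : ℝ) ^ max (1 - κ / 2) (3 / 4) := by
  open EventTriggered in
  obtain ⟨hκ₀, hκ₁⟩ := hκ
  obtain ⟨K, hK, hest⟩ := exists_estimates hn m B hF₁ hF₂ hR hw.1 hκ₀ hκ₁ hc
  -- The first bracket is the regret constant, the second the violation constant.
  refine ⟨(K + 2 * K + 8 * K ^ 3) + (3 * K + 3 * K * (1 + (12 * K + 16 * K ^ 3 + K))),
    by positivity, ?_⟩
  set C₁ := K + 2 * K + 8 * K ^ 3 with hC₁
  set A₀ := 12 * K + 16 * K ^ 3 + K with hA₀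
  set C₂ := 3 * K + 3 * K * (1 + A₀) with hC₂
  have hC₁0 : 0 < C₁ := by positivity
  have hA₀0 : 0 < A₀ := by positivity
  have hC₂0 : 0 < C₂ := by positivity
  intro p P hD hP hN T hT hfeas S hS
  obtain ⟨hbasic, hstep, hlow, hreg, hccv⟩ := hest hD hP hN hT hS
  have hT1 : (1 : ℝ) ≤ T := by exact_mod_cast hT
  have hT0 : (0 : ℝ) < T := by linarith
  set A := totalStep S T with hA
  set Q := stepEnergy (stepAlpha (geomThreshold c)) S T with hQ
  set X := (T : ℝ) ^ max κ (1 / 2) with hX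
  set Y := (T : ℝ) ^ (1 / 2 : ℝ) with hY
  have hYX : Y ≤ X := Real.rpow_le_rpow_of_exponent_le hT1 (le_max_right _ _)
  have hY1 : 1 ≤ Y := Real.one_le_rpow hT1 (by norm_num)
  have hXT : X ≤ T := by
    refine (Real.rpow_le_rpow_of_exponent_le hT1 (max_le hκ₁.le ?_)).trans_eq (Real.rpow_one _)
    norm_num
  constructor
  · intro y hy
    have hPL : 0 ≤ pathLength T y := Finset.sum_nonneg fun _ _ => norm_nonneg _
    have h1 := hbasic y hy 0 le_rfl
    -- The basic inequality and the network regret each contribute `K * A`; with `s = 4 * K` the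
    -- total `2 * K * A` costs exactly the available `Q / 2`.
    have h2 := hstep (4 * K) (by positivity)
    have h3 : 2 * K * A ≤ Q / 2 + 8 * K ^ 3 * Y := by
      have := mul_le_mul_of_nonneg_left h2 (by positivity : 0 ≤ 2 * K)
      calc 2 * K * A ≤ _ := this
        _ = _ := by field_simp; ring
    have h4 : localRegret P S T y + K * (1 + A) ≤ C₁ * (X + Y * pathLength T y) := by
      have e1 : 0 ≤ Y * pathLength T y := by positivity
      have e2 : 8 * K ^ 3 * Y ≤ 8 * K ^ 3 * X := by gcongr
      have e3 : 2 * K * 1 ≤ 2 * K * X := by gcongr; linarith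
      have e4 : 0 ≤ (2 * K + 8 * K ^ 3) * (Y * pathLength T y) := by positivity
      rw [hC₁]
      linarith
    have hn1 : 1 / (n : ℝ) ≤ 1 := by
      rw [div_le_one (by exact_mod_cast hn)]; exact_mod_cast hn
    have h5 : 0 ≤ X + Y * pathLength T y := by positivity
    calc netReg P T S.x y ≤ _ := hreg y hy
      _ ≤ 1 / (n : ℝ) * (C₁ * (X + Y * pathLength T y)) := by gcongr
      _ ≤ C₁ * (X + Y * pathLength T y) := mul_le_of_le_one_left (by positivity) hn1
      _ ≤ (C₁ + C₂) * (X + Y * pathLength T y) := by gcongr; linarith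
  · obtain ⟨x₀, hx₀⟩ := hfeas
    have hy : (fun _ => x₀) ∈ P.feasibleSequences T := fun t ht => ⟨hx₀.1, hx₀.2 t ht⟩
    have hPL : pathLength T (fun _ => x₀) = 0 := by simp [pathLength]
    have hl := hlow _ hy
    -- With `r = 0` and regret at least `-K * T`, half the energy is bounded by `O(T) + K * A`; the
    -- choice `s = 4 * K` returns only `Q / 4`.
    have hQT : Q ≤ (12 * K + 16 * K ^ 3) * T := by
      have h1 := hbasic _ hy 0 le_rfl
      have h2 := hstep (4 * K) (by positivity)
      have h3 : K * A ≤ Q / 4 + 4 * K ^ 3 * Y := by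
        have := mul_le_mul_of_nonneg_left h2 hK.le
        calc K * A ≤ _ := this
          _ = _ := by field_simp
      rw [hPL] at h1
      have e1 : K * X ≤ K * T := by gcongr
      have e2 : 4 * K ^ 3 * Y ≤ 4 * K ^ 3 * T := by gcongr; linarith
      have e3 : K * 1 ≤ K * T := by gcongr
      linarith
    set H := (T : ℝ) ^ (3 / 4 : ℝ) with hH
    have hH1 : 1 ≤ H := Real.one_le_rpow hT1 (by norm_num)
    have hAT : A ≤ A₀ * H := by
      -- This `s` balances `Q / s` with `Q = O(T)` against `s * √T`; both become `T ^ (3/4)`.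
      have h1 := hstep ((T : ℝ) ^ (1 / 4 : ℝ)) (by positivity)
      have h2 : (T : ℝ) = H * (T : ℝ) ^ (1 / 4 : ℝ) := by
        rw [hH, ← Real.rpow_add hT0]; norm_num
      have h3 : (T : ℝ) ^ (1 / 4 : ℝ) * Y = H := by
        rw [hH, hY, ← Real.rpow_add hT0]; norm_num
      have h4 : Q / (T : ℝ) ^ (1 / 4 : ℝ) ≤ (12 * K + 16 * K ^ 3) * H := by
        rw [div_le_iff₀ (by positivity), mul_assoc, ← h2]
        exact hQT
      have h5 : (T : ℝ) ^ (1 / 4 : ℝ) * (K * Y) = K * H := by rw [← h3]; ring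
      rw [hA₀]
      linarith
    -- This is the largest power of `T` for which `r ^ 2 * T ^ (1 - κ)` stays of order `T`, the size
    -- already forced by the lower bound on the regret.
    set r := (T : ℝ) ^ (κ / 2) with hr
    have hr1 : 1 ≤ r := Real.one_le_rpow hT1 (by positivity)
    have hr0 : 0 < r := by linarith
    set J := (T : ℝ) ^ (1 - κ / 2) with hJ
    have hJr : r * J = T := by
      rw [hr, hJ, ← Real.rpow_add hT0]; simp
    have hr2 : r ^ 2 * (T : ℝ) ^ (1 - κ) = T := by
      rw [hr, ← Real.rpow_natCast, ← Real.rpow_mul hT0.le, ← Real.rpow_add hT0]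
      norm_num
    have hA1 : 1 + A ≤ (1 + A₀) * H := by linarith
    have hV : localViolation P S T ≤ 3 * K * J + 2 * K * ((1 + A₀) * H) := by
      have h1 := hbasic _ hy r hr0.le
      rw [hPL, hr2] at h1
      have hQ0 : 0 ≤ Q := Finset.sum_nonneg fun t _ => Finset.sum_nonneg fun i _ =>
        div_nonneg (by positivity) (Real.sqrt_nonneg _)
      have h2 : (1 + r) * (1 + A) ≤ 2 * r * ((1 + A₀) * H) := by
        refine mul_le_mul (by linarith) hA1 ?_ (by positivity)
        have : 0 ≤ A := totalStep_nonneg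
        linarith
      have h3 := mul_le_mul_of_nonneg_left h2 hK.le
      have h4 : K * X ≤ K * T := by gcongr
      refine le_of_mul_le_mul_left ?_ hr0
      have h5 : r * (3 * K * J + 2 * K * ((1 + A₀) * H)) =
          3 * K * T + K * (2 * r * ((1 + A₀) * H)) := by rw [← hJr]; ring
      rw [h5]
      linarith
    set Z := (T : ℝ) ^ max (1 - κ / 2) (3 / 4) with hZ
    have hJZ : J ≤ Z := Real.rpow_le_rpow_of_exponent_le hT1 (le_max_left _ _)
    have hHZ : H ≤ Z := Real.rpow_le_rpow_of_exponent_le hT1 (le_max_right _ _)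
    calc netCCV P T S.x ≤ localViolation P S T + K * (1 + A) := hccv
      _ ≤ (3 * K * J + 2 * K * ((1 + A₀) * H)) + K * ((1 + A₀) * H) := by gcongr
      _ = 3 * K * J + 3 * K * (1 + A₀) * H := by ring
      _ ≤ 3 * K * Z + 3 * K * (1 + A₀) * Z := by gcongr
      _ = C₂ * Z := by rw [hC₂]; ring
      _ ≤ (C₁ + C₂) * Z := by gcongr; linarith
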